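/- **Setting.** Let $\mathcal X$ be a measurable space, $m_0$ a probability measure on $\mathcal X$, $q(x,dx')$ a Markov kernel on $\mathcal X$, and $G_k:\mathcal X\to[0,\infty)$, $k\ge 0$, measurable functions with $\int G_0\,dm_0>0$. For $n\ge 1$ let $\pi_n$ be the probability measure on $\mathcal X^{n+1}$ given by $$\pi_n(dx_{0:n})\propto m_0(dx_0)\prod_{i=0}^{n-1}G_i(x_i)\,q(x_i,dx_{i+1})\;G_n(x_n).$$ For $N\ge 1$ let $P_n^N$ be the conditional SMC Markov kernel on $\mathcal X^{n+1}$: given a reference path $\bar x_{0:n}$, put $X_k^0=\bar x_k$ for $0\le k\le n$ and draw $X_0^1,\dots,X_0^N$ i.i.d. from $m_0$. For $k=1,\dots,n$ draw independently, for $i=1,\dots,N$, ancestor indices $A_{k-1}^i\in\{0,\dots,N\}$ with probabilities $w_{k-1}^j=G_{k-1}(X_{k-1}^j)/\sum_{l=0}^N G_{k-1}(X_{k-1}^l)$, $0\le j\le N$, and then, independently, $X_k^i\sim q(X_{k-1}^{A_{k-1}^i},\cdot)$. Finally draw $N^*\in\{0,\dots,N\}$ with probabilities $w_n^j$ (defined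 in the same way), and return $(X_k^{B_k})_{0\le k\le n}$, where $B_n=N^*$ and $B_k=A_k^{B_{k+1}}$ for $k=n-1,\dots,0$, with $A_k^0=0$. (If all the potentials in a selection step vanish, index $0$ is selected.) For $0\le k<n$ put $p_{k+1:n}(x_k)=\int\prod_{j=k+1}^n q(x_{j-1},dx_j)\,G_j(x_j)$. Assume: * (A1) there is $\underline g>0$ such that $\underline g\le p_{k+1:n}(x)/p_{k+1:n}(x')\le\underline g^{-1}$ for all $0\le k<n$ and all $x,x'\in\mathcal X$; * (A2) there is $a>0$ such that $G_n(x)\le a$ for all $n\ge 0$ and $x\in\mathcal X$. Say that $c>0$ is *admissible up to time $n$* if $\int G_0\,dm_0>c^{-1}$ and $\int q(x,dx')\,G_k(x')>c^{-1}$ for all $1\le k\le n$ and $x\in\mathcal X$. **Statement.** 1. For every $n$ there is a $c$ that is admissible up to time $n$. 2. For all $n\ge1$, every $c$ admissible up to time $n$, all $N\ge1$, $m\ge1$, all measurable $f_n:\mathcal X^{n+1}\to\mathbb R$ with $\|f_n\|_\infty\le1$ and every reference path $\bar x_{0:n}\in\mathcal X^{n+1}$, $$\left|(P_n^N)^m(f_n)(\bar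 x_{0:n})-\pi_n(f_n)\right|\le\left(\frac{2(n+1)\,ac\,\underline g^{-1}-1}{N-1+2ac\,\underline g^{-1}}+\frac{n\,(ac\,\underline g^{-1})^2}{N}\right)^m .$$ 3. If $c$ is admissible up to every time $n$, then for every real $C>0$, all $n\ge1$ such that $N_n=C(n+1)+1$ is an integer, all $m\ge1$, and all $f_n$, $\bar x_{0:n}$ as in 2, $$\left|(P_n^{N_n})^m(f_n)(\bar x_{0:n})-\pi_n(f_n)\right|\le\frac{ac\,\underline g^{-1}\,(2+ac\,\underline g^{-1})}{C},$$ so the error is bounded uniformly in $n$. -/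

import Mathlib

open MeasureTheory ProbabilityTheory
open scoped ENNReal ProbabilityTheory

noncomputable section

namespace CSMC

variable {X : Type*} [MeasurableSpace X]

lemma measurable_snoc {S Y : Type*} [MeasurableSpace S] [MeasurableSpace Y] {n : ℕ}
    {f : S → Fin n → Y} {g : S → Y} (hf : Measurable f) (hg : Measurable g) :
    Measurable (fun s => (Fin.snoc (f s) (g s) : Fin (n + 1) → Y)) := by
  refine measurable_pi_lambda _ fun i => ?_
  induction i using Fin.lastCases with
  | last => simpa using hg
  | cast i => simpa using measurable_pi_iff.1 hf i

lemma measurable_cons {S Y : Type*} [MeasurableSpace S] [MeasurableSpace Y] {n : ℕ}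
    {f : S → Fin n → Y} {g : S → Y} (hf : Measurable f) (hg : Measurable g) :
    Measurable (fun s => (Fin.cons (g s) (f s) : Fin (n + 1) → Y)) := by
  refine measurable_pi_lambda _ fun i => ?_
  induction i using Fin.cases with
  | zero => simpa using hg
  | succ i => simpa using measurable_pi_iff.1 hf i

/-- The product kernel `x ↦ ⨂ᵢ κ i x` of finitely many Markov kernels. -/
def piKernel {S Y ι : Type*} [MeasurableSpace S] [MeasurableSpace Y] [Fintype ι]
    (κ : ι → Kernel S Y) [∀ i, IsMarkovKernel (κ i)] : Kernel S (ι → Y) where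
  toFun x := Measure.pi fun i => κ i x
  measurable' := by
    refine Measurable.measure_of_isPiSystem_of_isProbabilityMeasure
      generateFrom_pi.symm isPiSystem_pi ?_
    rintro _ ⟨s, hs, rfl⟩
    simp only [Measure.pi_pi]
    exact Finset.measurable_prod _ fun i _ => (κ i).measurable_coe (hs i (Set.mem_univ i))

instance {S Y ι : Type*} [MeasurableSpace S] [MeasurableSpace Y] [Fintype ι]
    (κ : ι → Kernel S Y) [∀ i, IsMarkovKernel (κ i)] : IsMarkovKernel (piKernel κ) :=
  ⟨fun x => inferInstanceAs (IsProbabilityMeasure (Measure.pi fun i => κ i x))⟩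

/-! ### The target measure -/

/-- The law of `X_{0:n}` for the Markov chain with initial law `m₀` and transition kernel `q`. -/
def chainLaw (m₀ : Measure X) (q : Kernel X X) : (n : ℕ) → Measure (Fin (n + 1) → X)
  | 0 => m₀.map fun x _ => x
  | n + 1 =>
      ((chainLaw m₀ q n) ⊗ₘ q.comap (fun x => x (Fin.last n)) (measurable_pi_apply _)).map
        fun p => (Fin.snoc p.1 p.2 : Fin (n + 2) → X)

instance (m₀ : Measure X) [IsProbabilityMeasure m₀] (q : Kernel X X) [IsMarkovKernel q] (n : ℕ) :
    IsProbabilityMeasure (chainLaw m₀ q n) := by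
  induction n with
  | zero =>
    exact Measure.isProbabilityMeasure_map (measurable_pi_lambda _ fun _ => measurable_id).aemeasurable
  | succ n ih =>
    exact Measure.isProbabilityMeasure_map
      (measurable_snoc measurable_fst measurable_snd).aemeasurable

/-- `π_n`: the law of `X_{0:n}` reweighted by `∏_{k ≤ n} G_k(x_k)` and normalised. -/
def target (m₀ : Measure X) (q : Kernel X X) (G : ℕ → X → ℝ) (n : ℕ) :
    Measure (Fin (n + 1) → X) :=
  let γ := (chainLaw m₀ q n).withDensity fun x => ENNReal.ofReal (∏ k : Fin (n + 1), G k (x k))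
  (γ Set.univ)⁻¹ • γ

/-- `futureWeight q G k j x` is the iterated integral
`∫ ∏_{i = k+1}^{k+j} q(x_{i-1}, dx_i) G_i(x_i)` started from `x_k = x`. -/
def futureWeight (q : Kernel X X) (G : ℕ → X → ℝ) : (k j : ℕ) → X → ℝ
  | _, 0, _ => 1
  | k, j + 1, x => ∫ y, G (k + 1) y * futureWeight q G (k + 1) j y ∂(q x)

/-- `pFuture q G k n x` is `p_{k+1:n}(x) = ∫ ∏_{i = k+1}^{n} q(x_{i-1}, dx_i) G_i(x_i)`,
`x_k = x`, for `k < n`. -/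
def pFuture (q : Kernel X X) (G : ℕ → X → ℝ) (k n : ℕ) (x : X) : ℝ :=
  futureWeight q G k (n - k) x

/-! ### The conditional SMC algorithm

Particles at one time are indexed by `Fin (N + 1)`; index `0` is the reference path. -/

/-- The multinomial selection law on `{0, …, N}` with weights `w_i = g(z_i) / ∑_j g(z_j)`, for a
nonnegative function `g`; if all the `g(z_j)` vanish the reference index `0` is selected. -/
def select (N : ℕ) (g : X → ℝ) (hg : Measurable g) :
    Kernel (Fin (N + 1) → X) (Fin (N + 1)) where
  toFun z :=
    open Classical in
    if ∑ j, ENNReal.ofReal (g (z j)) = 0 then Measure.dirac 0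
    else ∑ i, (ENNReal.ofReal (g (z i)) / ∑ j, ENNReal.ofReal (g (z j))) • Measure.dirac i
  measurable' := by
    have h : ∀ i : Fin (N + 1), Measurable fun z : Fin (N + 1) → X => ENNReal.ofReal (g (z i)) :=
      fun i => ENNReal.measurable_ofReal.comp (hg.comp (measurable_pi_apply i))
    have hs : Measurable fun z : Fin (N + 1) → X => ∑ j, ENNReal.ofReal (g (z j)) :=
      Finset.measurable_sum _ fun j _ => h j
    refine Measurable.ite (hs (measurableSet_singleton 0)) measurable_const ?_
    refine Measure.measurable_of_measurable_coe _ fun s _ => ?_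
    simp only [Measure.finsetSum_apply, Measure.smul_apply, smul_eq_mul]
    exact Finset.measurable_sum _ fun i _ => ((h i).div hs).mul_const _

instance (N : ℕ) (g : X → ℝ) (hg : Measurable g) : IsMarkovKernel (select N g hg) := by
  refine ⟨fun z => ?_⟩
  by_cases h0 : ∑ j, ENNReal.ofReal (g (z j)) = 0
  · have : select N g hg z = Measure.dirac 0 := if_pos h0
    rw [this]; infer_instance
  · have : select N g hg z =
      ∑ i, (ENNReal.ofReal (g (z i)) / ∑ j, ENNReal.ofReal (g (z j))) • Measure.dirac i :=
      if_neg h0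
    refine ⟨?_⟩
    simp only [this, Measure.finsetSum_apply, Measure.smul_apply, smul_eq_mul, measure_univ,
      mul_one, div_eq_mul_inv, ← Finset.sum_mul]
    exact ENNReal.mul_inv_cancel h0 (ENNReal.sum_ne_top.2 fun i _ => ENNReal.ofReal_ne_top)

/-- Selection step: given `X_k^0, …, X_k^N`, the ancestor indices `A_k^1, …, A_k^N` are drawn
independently from the multinomial selection law. -/
def resample (N : ℕ) (g : X → ℝ) (hg : Measurable g) :
    Kernel (Fin (N + 1) → X) (Fin N → Fin (N + 1)) :=
  piKernel fun _ => select N g hg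

/-- Propagation step: given `X_k^0, …, X_k^N` and the ancestor indices `A_k^i`, the new particles
`X_{k+1}^i ∼ q(· | X_k^{A_k^i})`, `1 ≤ i ≤ N`, are drawn independently. -/
def propagate (N : ℕ) (q : Kernel X X) [IsMarkovKernel q] :
    Kernel ((Fin (N + 1) → X) × (Fin N → Fin (N + 1))) (Fin N → X) :=
  piKernel fun i => q.comap (fun p => p.1 (p.2 i)) <|
    measurable_from_prod_countable_left fun a => measurable_pi_apply (a i)

/-- The particles `X_k^i` and the ancestor indices `A_k^i`, `1 ≤ i ≤ N`, of the particle system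
up to time `n`; the particle with label `i` in `{1, …, N}` is stored at position `i - 1`. -/
abbrev System (X : Type*) (N n : ℕ) : Type _ :=
  (Fin (n + 1) → Fin N → X) × (Fin n → Fin N → Fin (N + 1))

/-- All particles `X_k^0 = x̄_k, X_k^1, …, X_k^N` at time `k`. -/
def withRef {N : ℕ} (r : X) (z : Fin N → X) : Fin (N + 1) → X := Fin.cons r z

instance (N : ℕ) (g : X → ℝ) (hg : Measurable g) : IsMarkovKernel (resample N g hg) :=
  inferInstanceAs (IsMarkovKernel (piKernel _))

instance (N : ℕ) (q : Kernel X X) [IsMarkovKernel q] : IsMarkovKernel (propagate N q) :=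
  inferInstanceAs (IsMarkovKernel (piKernel _))

lemma measurable_currentParticles {N n l : ℕ} (j : Fin (l + 1)) :
    Measurable fun p : (Fin (l + 1) → X) × System X N n =>
      withRef (p.1 j) (p.2.1 (Fin.last n)) :=
  measurable_cons ((measurable_pi_apply _).comp (measurable_fst.comp measurable_snd))
    ((measurable_pi_apply _).comp measurable_fst)

/-- One selection and propagation step of the algorithm from time `n` to time `n + 1`, given the
reference path `x̄_{0:n+1}` and the particle system up to time `n`. -/
def step (q : Kernel X X) [IsMarkovKernel q] (G : ℕ → X → ℝ) (hG : ∀ k, Measurable (G k))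
    (N n : ℕ) :
    Kernel ((Fin (n + 2) → X) × System X N n) ((Fin N → Fin (N + 1)) × (Fin N → X)) :=
  (resample N (G n) (hG n) ⊗ₖ propagate N q).comap
    (fun p => withRef (p.1 (Fin.last n).castSucc) (p.2.1 (Fin.last n)))
    (measurable_currentParticles _)

instance (q : Kernel X X) [IsMarkovKernel q] (G : ℕ → X → ℝ) (hG : ∀ k, Measurable (G k))
    (N n : ℕ) : IsMarkovKernel (step q G hG N n) :=
  Kernel.IsMarkovKernel.comap _ _

/-- Selection of the final index `N*` at time `n`, given the reference path `x̄_{0:n}` and the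
particle system up to time `n`. -/
def finalSelect (G : ℕ → X → ℝ) (hG : ∀ k, Measurable (G k)) (N n : ℕ) :
    Kernel ((Fin (n + 1) → X) × System X N n) (Fin (N + 1)) :=
  (select N (G n) (hG n)).comap (fun p => withRef (p.1 (Fin.last n)) (p.2.1 (Fin.last n)))
    (measurable_currentParticles _)

instance (G : ℕ → X → ℝ) (hG : ∀ k, Measurable (G k)) (N n : ℕ) :
    IsMarkovKernel (finalSelect G hG N n) :=
  Kernel.IsMarkovKernel.comap _ _

/-- The law of the particle system up to time `n` (the conditional SMC algorithm), as a kernel in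
the reference path `x̄_{0:n}`. -/
def system (m₀ : Measure X) (q : Kernel X X) [IsMarkovKernel q]
    (G : ℕ → X → ℝ) (hG : ∀ k, Measurable (G k)) (N : ℕ) :
    (n : ℕ) → Kernel (Fin (n + 1) → X) (System X N n)
  | 0 => Kernel.const _ ((Measure.pi fun _ : Fin N => m₀).map fun z => (fun _ => z, Fin.elim0))
  | n + 1 =>
      ((system m₀ q G hG N n).comap (fun (r : Fin (n + 2) → X) (k : Fin (n + 1)) => r k.castSucc)
          (measurable_pi_lambda _ fun _ => measurable_pi_apply _) ⊗ₖ step q G hG N n).map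
        fun p => (Fin.snoc p.1.1 p.2.2, Fin.snoc p.1.2 p.2.1)

instance (m₀ : Measure X) [IsProbabilityMeasure m₀] (q : Kernel X X) [IsMarkovKernel q]
    (G : ℕ → X → ℝ) (hG : ∀ k, Measurable (G k)) (N n : ℕ) :
    IsMarkovKernel (system m₀ q G hG N n) := by
  induction n with
  | zero =>
    have : IsProbabilityMeasure ((Measure.pi fun _ : Fin N => m₀).map
        fun z => ((fun _ => z, Fin.elim0) : System X N 0)) :=
      Measure.isProbabilityMeasure_map
        ((measurable_pi_lambda _ fun _ => measurable_id).prodMk measurable_const).aemeasurable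
    exact inferInstanceAs (IsMarkovKernel (Kernel.const _ _))
  | succ n ih =>
    exact Kernel.IsMarkovKernel.map _
      ((measurable_snoc (measurable_fst.comp measurable_fst)
          (measurable_snd.comp measurable_snd)).prodMk
        (measurable_snoc (measurable_snd.comp measurable_fst)
          (measurable_fst.comp measurable_snd)))

/-- The ancestral lineage `B_0, …, B_n` of the particle with index `i` at time `n`:
`B_n = i` and `B_k = A_k^{B_{k+1}}`, the ancestor of the reference particle `0` being `0`. -/
def lineage {N : ℕ} : (n : ℕ) → (Fin n → Fin N → Fin (N + 1)) → Fin (N + 1) →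
    (Fin (n + 1) → Fin (N + 1))
  | 0, _, i => fun _ => i
  | n + 1, A, i =>
      Fin.snoc (lineage n (Fin.init A)
        ((Fin.cons 0 (A (Fin.last n)) : Fin (N + 1) → Fin (N + 1)) i)) i

/-- The path `(X_k^{B_k})_{0 ≤ k ≤ n}` ending in the particle with index `i` at time `n`. -/
def tracedPath {N n : ℕ} (r : Fin (n + 1) → X) (s : System X N n) (i : Fin (N + 1)) :
    Fin (n + 1) → X :=
  fun k => withRef (r k) (s.1 k) (lineage n s.2 i k)

lemma measurable_tracedPath {N n : ℕ} :
    Measurable fun p : (Fin (n + 1) → X) × (System X N n × Fin (N + 1)) =>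
      tracedPath p.1 p.2.1 p.2.2 := by
  have key : ∀ (A : Fin n → Fin N → Fin (N + 1)) (i : Fin (N + 1)),
      Measurable fun p : (Fin (n + 1) → X) × (Fin (n + 1) → Fin N → X) =>
        tracedPath p.1 ((p.2, A) : System X N n) i := fun A i => by
    refine measurable_pi_lambda _ fun k => ?_
    have h : Measurable fun p : (Fin (n + 1) → X) × (Fin (n + 1) → Fin N → X) =>
        withRef (p.1 k) (p.2 k) :=
      measurable_cons ((measurable_pi_apply k).comp measurable_snd)
        ((measurable_pi_apply k).comp measurable_fst)
    exact measurable_pi_iff.1 h (lineage n A i k)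
  have h : Measurable fun p : ((Fin (n + 1) → X) × (Fin (n + 1) → Fin N → X)) ×
      ((Fin n → Fin N → Fin (N + 1)) × Fin (N + 1)) =>
        tracedPath p.1.1 ((p.1.2, p.2.1) : System X N n) p.2.2 :=
    measurable_from_prod_countable_left fun b => key b.1 b.2
  exact h.comp (by fun_prop : Measurable fun p : (Fin (n + 1) → X) × (System X N n × Fin (N + 1)) =>
    ((p.1, p.2.1.1), (p.2.1.2, p.2.2)))

/-- The conditional SMC kernel `P_n^N`: run the particle system with reference path `x̄_{0:n}`,
draw `N*` from the multinomial selection law at time `n`, and return the path of the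
particle `N*`. -/
def csmc (m₀ : Measure X) (q : Kernel X X) [IsMarkovKernel q]
    (G : ℕ → X → ℝ) (hG : ∀ k, Measurable (G k)) (N n : ℕ) :
    Kernel (Fin (n + 1) → X) (Fin (n + 1) → X) :=
  (Kernel.id ×ₖ (system m₀ q G hG N n ⊗ₖ finalSelect G hG N n)).map
    fun p => tracedPath p.1 p.2.1 p.2.2

instance (m₀ : Measure X) [IsProbabilityMeasure m₀] (q : Kernel X X) [IsMarkovKernel q]
    (G : ℕ → X → ℝ) (hG : ∀ k, Measurable (G k)) (N n : ℕ) :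
    IsMarkovKernel (csmc m₀ q G hG N n) :=
  Kernel.IsMarkovKernel.map _ measurable_tracedPath

/-! ### The constants in the assumptions -/

/-- `m₀(G_0) > c⁻¹` and `∫ q(x, dx') G_k(x') > c⁻¹` for all `x` and `1 ≤ k ≤ n`. -/
def PotentialBound (m₀ : Measure X) (q : Kernel X X) (G : ℕ → X → ℝ) (n : ℕ) (c : ℝ) : Prop :=
  0 < c ∧ c⁻¹ < ∫ x, G 0 x ∂m₀ ∧ ∀ k, 1 ≤ k → k ≤ n → ∀ x, c⁻¹ < ∫ y, G k y ∂(q x)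

end CSMC

end

noncomputable section

namespace CSMC

variable {X : Type*} [MeasurableSpace X]

/-! ### Product measures -/

/-! Represent every particle by its traced path. The `N + 1` traced paths form a Markov chain in
time: given the current population, the `N` new paths are i.i.d., each a path selected by the
potential of its endpoint and extended by `q`, while index `0` carries the reference
(`lintegral_population_succ`). Write `A = a c g⁻¹`.

Invariance. If the reference is drawn from the unnormalised predictive measure, the population is
exchangeable (`exchangeableLaw_perm`): averaging over the index of the path that the reference
continues turns the reference into one more draw from the offspring law. Averaging the final
selection over the index of the reference in the same way shows that `π_n` is invariant
(`lintegral_csmc_predictive`).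

Bias. Select among one fixed point and `N` i.i.d. points of law `μ`, with weights `w ≤ b ≤ α μ(w)`.
For test functions in `[0, 1]` the result exceeds the law `w μ / μ(w)` by at most `α / (N + 1)`
(`lintegral_selectAvg_le`). With `w_k = G_k p_{k+1:n}` the assumptions give `α = A` at every time,
and the recursion `w_k = G_k q(w_{k+1})` turns the main term at time `k + 1` into the same problem
at time `k`. Hence each of the `n + 1` times costs `A / (N + 1)` (`lintegral_population_le`), and
the error of one iteration is at most `ρ = 2 (n + 1) A / (N + 1)` when `|f| ≤ 1`.

Iteration. By invariance the error after `m` iterations is at most `ρ ^ m`, and also at most `ρ`,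
without any need for `ρ < 1`. Here `ρ` lies below the bracket of statement 2 (`bias_le_rate`), and
below `2 A / C` in statement 3. Statement 1 is (A1) applied to `p_{k:k} = ∫ q(·, dy) G_k(y)`. -/

lemma lintegral_pi_insertNth {Y : Type*} [MeasurableSpace Y] (μ : Measure Y)
    [IsProbabilityMeasure μ] {N : ℕ} (i : Fin (N + 1)) {F : (Fin (N + 1) → Y) → ℝ≥0∞}
    (hF : Measurable F) :
    ∫⁻ y, F y ∂(Measure.pi fun _ : Fin (N + 1) => μ) =
      ∫⁻ x, ∫⁻ z, F (i.insertNth x z) ∂(Measure.pi fun _ : Fin N => μ) ∂μ := by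
  have h := (measurePreserving_piFinSuccAbove (fun _ : Fin (N + 1) => μ) i).symm
  have hm : Measurable fun p : Y × (Fin N → Y) => F (i.insertNth p.1 p.2) :=
    hF.comp (MeasurableEquiv.piFinSuccAbove (fun _ => Y) i).symm.measurable
  rw [← h.map_eq, lintegral_map hF h.measurable]
  exact lintegral_prod _ hm.aemeasurable

lemma lintegral_pi_perm {Y ι : Type*} [MeasurableSpace Y] [Fintype ι] (μ : Measure Y)
    [IsProbabilityMeasure μ] (σ : Equiv.Perm ι) {F : (ι → Y) → ℝ≥0∞} (hF : Measurable F) :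
    ∫⁻ y, F (fun i => y (σ i)) ∂(Measure.pi fun _ : ι => μ) =
      ∫⁻ y, F y ∂(Measure.pi fun _ : ι => μ) := by
  have h := measurePreserving_piCongrLeft (fun _ : ι => μ) σ.symm
  have h2 : (⇑(MeasurableEquiv.piCongrLeft (fun _ : ι => Y) σ.symm)) =
      fun y i => y (σ i) := by
    ext y i
    have := MeasurableEquiv.piCongrLeft_apply_apply (β := fun _ : ι => Y) σ.symm y (σ i)
    simpa using this
  conv_rhs => rw [← h.map_eq, lintegral_map hF h.measurable]
  simp only [h2]

/-- Sampling i.i.d. from a finite mixture amounts to sampling i.i.d. components first. -/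
lemma lintegral_pi_mixture {Y Z J ι : Type*} [MeasurableSpace Y] [MeasurableSpace Z] [Fintype J]
    [MeasurableSpace J] [MeasurableSingletonClass J] [Fintype ι]
    (ν : Measure J) [IsProbabilityMeasure ν]
    (κ : J → Measure Z) [∀ j, IsProbabilityMeasure (κ j)] {φ : J → Z → Y}
    (hφ : ∀ j, Measurable (φ j)) (μ : Measure Y) [IsProbabilityMeasure μ]
    (hμ : ∀ s, MeasurableSet s → μ s = ∫⁻ j, κ j (φ j ⁻¹' s) ∂ν)
    {H : (ι → Y) → ℝ≥0∞} (hH : Measurable H) :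
    ∫⁻ y, H y ∂(Measure.pi fun _ : ι => μ) =
      ∫⁻ A : ι → J, ∫⁻ z, H (fun i => φ (A i) (z i)) ∂(Measure.pi fun i => κ (A i))
        ∂(Measure.pi fun _ : ι => ν) := by
  classical
  have hφ' : ∀ A : ι → J, Measurable fun (z : ι → Z) i => φ (A i) (z i) := fun A =>
    measurable_pi_lambda _ fun i => (hφ _).comp (measurable_pi_apply i)
  let ρ : (ι → J) → Measure (ι → Y) := fun A =>
    (Measure.pi fun i => κ (A i)).map fun z i => φ (A i) (z i)
  have hρ : Measurable ρ := measurable_of_countable _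
  have key : (Measure.pi fun _ : ι => μ) = (Measure.pi fun _ : ι => ν).bind ρ := by
    refine Measure.pi_eq fun s hs => ?_
    rw [Measure.bind_apply (MeasurableSet.univ_pi hs) hρ.aemeasurable]
    have h1 : ∀ A : ι → J, ρ A (Set.univ.pi s) = ∏ i, κ (A i) (φ (A i) ⁻¹' s i) := fun A => by
      rw [Measure.map_apply (hφ' A) (MeasurableSet.univ_pi hs), ← Measure.pi_pi]
      rfl
    simp only [h1, hμ _ (hs _), lintegral_fintype, Measure.pi_singleton]
    -- On a box both sides are finite sums: expanding the product of mixtures gives one term per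
    -- index map `A`.
    rw [Finset.prod_univ_sum]
    simp [Finset.prod_mul_distrib]
  rw [key, Measure.lintegral_bind hρ.aemeasurable hH.aemeasurable]
  exact lintegral_congr fun A => lintegral_map hH (hφ' A)

/-! ### Weighted selection -/

open Classical in
/-- The weighted average of `v` with weights `w`, read as `v 0` if all the weights vanish. -/
def selectAvg {N : ℕ} (w v : Fin (N + 1) → ℝ≥0∞) : ℝ≥0∞ :=
  if ∑ j, w j = 0 then v 0 else ∑ i, w i / (∑ j, w j) * v i

lemma selectAvg_of_sum_eq_zero {N : ℕ} {w : Fin (N + 1) → ℝ≥0∞} (v : Fin (N + 1) → ℝ≥0∞)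
    (h : ∑ j, w j = 0) : selectAvg w v = v 0 := if_pos h

lemma selectAvg_of_sum_ne_zero {N : ℕ} {w : Fin (N + 1) → ℝ≥0∞} (v : Fin (N + 1) → ℝ≥0∞)
    (h : ∑ j, w j ≠ 0) : selectAvg w v = (∑ i, w i * v i) / ∑ j, w j := by
  rw [selectAvg, if_neg h, ENNReal.div_eq_inv_mul, Finset.mul_sum]
  exact Finset.sum_congr rfl fun i _ => by rw [ENNReal.div_eq_inv_mul, mul_assoc]

/-- Multiplication by the total weight erases the convention for vanishing weights; this is why the
convention does not disturb invariance. -/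
lemma sum_mul_selectAvg {N : ℕ} {w : Fin (N + 1) → ℝ≥0∞} (v : Fin (N + 1) → ℝ≥0∞)
    (hw : ∀ i, w i ≠ ∞) : (∑ j, w j) * selectAvg w v = ∑ i, w i * v i := by
  by_cases h : ∑ j, w j = 0
  · have h' : ∀ i, w i = 0 := by simpa using h
    simp [h']
  · rw [selectAvg_of_sum_ne_zero v h, ENNReal.mul_div_cancel h
      (ENNReal.sum_ne_top.2 fun i _ => hw i)]

lemma lintegral_select {N : ℕ} (g : X → ℝ) (hg : Measurable g) (z : Fin (N + 1) → X)
    (v : Fin (N + 1) → ℝ≥0∞) :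
    ∫⁻ i, v i ∂(select N g hg z) = selectAvg (fun i => ENNReal.ofReal (g (z i))) v := by
  by_cases h0 : ∑ j, ENNReal.ofReal (g (z j)) = 0
  · have : select N g hg z = Measure.dirac 0 := if_pos h0
    rw [this, lintegral_dirac, selectAvg_of_sum_eq_zero v h0]
  · have : select N g hg z =
      ∑ i, (ENNReal.ofReal (g (z i)) / ∑ j, ENNReal.ofReal (g (z j))) • Measure.dirac i :=
      if_neg h0
    rw [this, selectAvg, if_neg h0, lintegral_finsetSum_measure]
    simp [lintegral_smul_measure]

lemma measurable_selectAvg {S : Type*} [MeasurableSpace S] {N : ℕ}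
    {w v : S → Fin (N + 1) → ℝ≥0∞} (hw : Measurable w) (hv : Measurable v) :
    Measurable fun s => selectAvg (w s) (v s) := by
  have hw' := measurable_pi_iff.1 hw
  have hv' := measurable_pi_iff.1 hv
  have hs : Measurable fun s => ∑ j, w s j := Finset.measurable_sum _ fun j _ => hw' j
  exact Measurable.ite (hs (measurableSet_singleton 0)) (hv' 0)
    (Finset.measurable_sum _ fun i _ => ((hw' i).div hs).mul (hv' i))

/-! ### Populations of paths -/

/-- The kernel extending a path `x_{0:n}` by a transition `x_{n+1} ∼ q(x_n, ·)`. -/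
def extend (q : Kernel X X) (n : ℕ) : Kernel (Fin (n + 1) → X) (Fin (n + 2) → X) :=
  (Kernel.id ×ₖ q.comap (fun x => x (Fin.last n)) (measurable_pi_apply _)).map
    fun p => Fin.snoc p.1 p.2

lemma measurable_snoc_pair (n : ℕ) :
    Measurable fun p : (Fin (n + 1) → X) × X => (Fin.snoc p.1 p.2 : Fin (n + 2) → X) :=
  measurable_snoc measurable_fst measurable_snd

instance (q : Kernel X X) [IsMarkovKernel q] (n : ℕ) : IsMarkovKernel (extend q n) :=
  Kernel.IsMarkovKernel.map _ (measurable_snoc_pair n)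

lemma lintegral_extend (q : Kernel X X) [IsMarkovKernel q] {n : ℕ} (x : Fin (n + 1) → X)
    {F : (Fin (n + 2) → X) → ℝ≥0∞} (hF : Measurable F) :
    ∫⁻ y, F y ∂(extend q n x) = ∫⁻ t, F (Fin.snoc x t) ∂(q (x (Fin.last n))) := by
  have hF' : Measurable fun p : (Fin (n + 1) → X) × X => F (Fin.snoc p.1 p.2) :=
    hF.comp (measurable_snoc_pair n)
  rw [extend, Kernel.lintegral_map _ (measurable_snoc_pair n) _ hF,
    Kernel.lintegral_id_prod hF', Kernel.lintegral_comap]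

lemma lintegral_chainLaw_succ (m₀ : Measure X) [IsProbabilityMeasure m₀] (q : Kernel X X)
    [IsMarkovKernel q] (n : ℕ) {F : (Fin (n + 2) → X) → ℝ≥0∞} (hF : Measurable F) :
    ∫⁻ x, F x ∂(chainLaw m₀ q (n + 1)) =
      ∫⁻ x, ∫⁻ y, F y ∂(extend q n x) ∂(chainLaw m₀ q n) := by
  have hF' : Measurable fun p : (Fin (n + 1) → X) × X => F (Fin.snoc p.1 p.2) :=
    hF.comp (measurable_snoc_pair n)
  rw [chainLaw, lintegral_map hF (measurable_snoc_pair n), Measure.lintegral_compProd hF']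
  refine lintegral_congr fun x => ?_
  rw [lintegral_extend q x hF, Kernel.lintegral_comap]

/-- Selection of a path of a population according to the potential `G` of its endpoint, followed by
an extension with `q`. -/
def mutate (q : Kernel X X) [IsMarkovKernel q] (g : X → ℝ) (hg : Measurable g) (N n : ℕ) :
    Kernel (Fin (N + 1) → Fin (n + 1) → X) (Fin (n + 2) → X) :=
  ((select N g hg).comap (fun ξ i => ξ i (Fin.last n)) (by fun_prop) ⊗ₖ
    (extend q n).comap (fun p : (Fin (N + 1) → Fin (n + 1) → X) × Fin (N + 1) => p.1 p.2)
      (measurable_from_prod_countable_left fun i => measurable_pi_apply i)).snd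

instance (q : Kernel X X) [IsMarkovKernel q] (g : X → ℝ) (hg : Measurable g) (N n : ℕ) :
    IsMarkovKernel (mutate q g hg N n) := by
  unfold mutate; infer_instance

lemma lintegral_mutate (q : Kernel X X) [IsMarkovKernel q] (g : X → ℝ) (hg : Measurable g)
    {N n : ℕ} (ξ : Fin (N + 1) → Fin (n + 1) → X) {F : (Fin (n + 2) → X) → ℝ≥0∞}
    (hF : Measurable F) :
    ∫⁻ y, F y ∂(mutate q g hg N n ξ) =
      selectAvg (fun i => ENNReal.ofReal (g (ξ i (Fin.last n))))
        fun i => ∫⁻ y, F y ∂(extend q n (ξ i)) := by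
  have hF' : Measurable fun p : Fin (N + 1) × (Fin (n + 2) → X) => F p.2 :=
    hF.comp measurable_snd
  rw [mutate, Kernel.lintegral_snd _ _ hF, Kernel.lintegral_compProd _ _ _ hF',
    Kernel.lintegral_comap, ← lintegral_select g hg]
  simp

/-- The `N` i.i.d. offspring of a population. -/
def offspring (q : Kernel X X) [IsMarkovKernel q] (g : X → ℝ) (hg : Measurable g) (N n : ℕ) :
    Kernel (Fin (N + 1) → Fin (n + 1) → X) (Fin N → Fin (n + 2) → X) :=
  piKernel fun _ => mutate q g hg N n

instance (q : Kernel X X) [IsMarkovKernel q] (g : X → ℝ) (hg : Measurable g) (N n : ℕ) :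
    IsMarkovKernel (offspring q g hg N n) :=
  inferInstanceAs (IsMarkovKernel (piKernel _))

lemma offspring_apply (q : Kernel X X) [IsMarkovKernel q] (g : X → ℝ) (hg : Measurable g)
    {N n : ℕ} (ξ : Fin (N + 1) → Fin (n + 1) → X) :
    offspring q g hg N n ξ = Measure.pi fun _ => mutate q g hg N n ξ := rfl

/-- Links the two descriptions of a step: drawing all ancestors and then all positions is the same
as `N` independent draws from the mixture `mutate`. -/
lemma lintegral_offspring (q : Kernel X X) [IsMarkovKernel q] (g : X → ℝ) (hg : Measurable g)
    {N n : ℕ} (ξ : Fin (N + 1) → Fin (n + 1) → X) {H : (Fin N → Fin (n + 2) → X) → ℝ≥0∞}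
    (hH : Measurable H) :
    ∫⁻ y, H y ∂(offspring q g hg N n ξ) =
      ∫⁻ A, ∫⁻ z, H (fun i => Fin.snoc (ξ (A i)) (z i))
          ∂(Measure.pi fun i => q (ξ (A i) (Fin.last n)))
        ∂(Measure.pi fun _ : Fin N => select N g hg fun i => ξ i (Fin.last n)) := by
  have hφ : ∀ j, Measurable fun t : X => (Fin.snoc (ξ j) t : Fin (n + 2) → X) := fun j =>
    measurable_snoc measurable_const measurable_id
  refine lintegral_pi_mixture (select N g hg fun i => ξ i (Fin.last n))
    (fun j => q (ξ j (Fin.last n))) hφ (mutate q g hg N n ξ) (fun s hs => ?_) hH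
  rw [← lintegral_indicator_one hs,
    lintegral_mutate q g hg ξ (measurable_one.indicator hs), lintegral_select]
  congr 1
  ext j
  rw [lintegral_extend q _ (measurable_one.indicator hs), ← lintegral_indicator_one (hφ j hs)]
  rfl

/-! ### Traced paths as a Markov chain of populations -/

lemma tracedPath_zero {Y : Type*} {N : ℕ} :
    ∀ {n : ℕ} (r : Fin (n + 1) → Y) (s : System Y N n),
    tracedPath r s 0 = r := by
  have h : ∀ (n : ℕ) (A : Fin n → Fin N → Fin (N + 1)) k, lineage n A 0 k = 0 := by
    intro n
    induction n with
    | zero => intro A k; rfl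
    | succ n ih =>
      intro A k
      induction k using Fin.lastCases with
      | last => simp [lineage]
      | cast k => simpa [lineage] using ih (Fin.init A) k
  intro n r s
  ext k
  simp [tracedPath, h, withRef]

lemma tracedPath_last {Y : Type*} {N n : ℕ} (r : Fin (n + 1) → Y) (s : System Y N n) (i : Fin (N + 1)) :
    tracedPath r s i (Fin.last n) = withRef (r (Fin.last n)) (s.1 (Fin.last n)) i := by
  have : lineage n s.2 i (Fin.last n) = i := by
    cases n with
    | zero => rfl
    | succ n => simp [lineage]
  simp [tracedPath, this]

/-- The new traced paths depend on the past of the system only through the old traced paths; hence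
the Markov property of the population. -/
lemma tracedPath_snoc {Y : Type*} {N n : ℕ} (r : Fin (n + 2) → Y) (s : System Y N n)
    (A : Fin N → Fin (N + 1)) (z : Fin N → Y) :
    tracedPath r ((Fin.snoc s.1 z, Fin.snoc s.2 A) : System Y N (n + 1)) =
      Fin.cons r fun i => Fin.snoc (tracedPath (fun k : Fin (n + 1) => r k.castSucc) s (A i)) (z i)
      := by
  ext i k
  induction i using Fin.cases with
  | zero => simp [tracedPath_zero]
  | succ i =>
    induction k using Fin.lastCases with
    | last => simp [tracedPath_last, withRef]
    | cast k => simp [tracedPath, lineage]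

lemma measurable_tracedPath_population {N n : ℕ} :
    Measurable fun p : (Fin (n + 1) → X) × System X N n => tracedPath p.1 p.2 :=
  measurable_pi_lambda _ fun _ =>
    measurable_tracedPath.comp (measurable_fst.prodMk (measurable_snd.prodMk measurable_const))

/-- The law of the `N + 1` paths `(X_k^{B_k})_{0 ≤ k ≤ n}` of the particles at time `n`. -/
def population (m₀ : Measure X) (q : Kernel X X) [IsMarkovKernel q]
    (G : ℕ → X → ℝ) (hG : ∀ k, Measurable (G k)) (N n : ℕ) :
    Kernel (Fin (n + 1) → X) (Fin (N + 1) → Fin (n + 1) → X) :=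
  (Kernel.id ×ₖ system m₀ q G hG N n).map fun p => tracedPath p.1 p.2

instance (m₀ : Measure X) [IsProbabilityMeasure m₀] (q : Kernel X X) [IsMarkovKernel q]
    (G : ℕ → X → ℝ) (hG : ∀ k, Measurable (G k)) (N n : ℕ) :
    IsMarkovKernel (population m₀ q G hG N n) :=
  Kernel.IsMarkovKernel.map _ measurable_tracedPath_population

section

variable (m₀ : Measure X) [IsProbabilityMeasure m₀] (q : Kernel X X) [IsMarkovKernel q]
  (G : ℕ → X → ℝ) (hG : ∀ k, Measurable (G k)) (N : ℕ)

lemma lintegral_population {n : ℕ} (r : Fin (n + 1) → X)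
    {F : (Fin (N + 1) → Fin (n + 1) → X) → ℝ≥0∞} (hF : Measurable F) :
    ∫⁻ ξ, F ξ ∂(population m₀ q G hG N n r) =
      ∫⁻ s, F (tracedPath r s) ∂(system m₀ q G hG N n r) := by
  have hF' : Measurable fun p : (Fin (n + 1) → X) × System X N n => F (tracedPath p.1 p.2) :=
    hF.comp measurable_tracedPath_population
  rw [population, Kernel.lintegral_map _ measurable_tracedPath_population _ hF,
    Kernel.lintegral_id_prod hF']

/-- The integrand may use that the path with index `0` is the reference path. -/
lemma lintegral_population_congr {n : ℕ} (r : Fin (n + 1) → X)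
    {F F' : (Fin (N + 1) → Fin (n + 1) → X) → ℝ≥0∞} (hF : Measurable F) (hF' : Measurable F')
    (h : ∀ ξ, ξ 0 = r → F ξ = F' ξ) :
    ∫⁻ ξ, F ξ ∂(population m₀ q G hG N n r) = ∫⁻ ξ, F' ξ ∂(population m₀ q G hG N n r) := by
  rw [lintegral_population m₀ q G hG N r hF, lintegral_population m₀ q G hG N r hF']
  exact lintegral_congr fun s => h _ (tracedPath_zero r s)

lemma isProbabilityMeasure_map_const :
    IsProbabilityMeasure (m₀.map fun (x : X) (_ : Fin 1) => x) :=
  Measure.isProbabilityMeasure_map (measurable_pi_lambda _ fun _ => measurable_id).aemeasurable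

lemma measurable_cons_const {Y : Type*} [MeasurableSpace Y] {N : ℕ} (r : Y) :
    Measurable fun y : Fin N → Y => (Fin.cons r y : Fin (N + 1) → Y) :=
  measurable_cons measurable_id measurable_const

lemma lintegral_population_zero (r : Fin 1 → X)
    {F : (Fin (N + 1) → Fin 1 → X) → ℝ≥0∞} (hF : Measurable F) :
    ∫⁻ ξ, F ξ ∂(population m₀ q G hG N 0 r) =
      ∫⁻ y, F (Fin.cons r y) ∂(Measure.pi fun _ : Fin N => chainLaw m₀ q 0) := by
  have hc : Measurable fun (x : X) (_ : Fin 1) => x := measurable_pi_lambda _ fun _ => measurable_id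
  have := isProbabilityMeasure_map_const m₀
  have hs : Measurable fun z : Fin N → X => ((fun _ => z, Fin.elim0) : System X N 0) :=
    (measurable_pi_lambda _ fun _ => measurable_id).prodMk measurable_const
  have ht : Measurable fun s : System X N 0 => F (tracedPath r s) :=
    hF.comp (measurable_tracedPath_population.comp measurable_prodMk_left)
  have hr : Measurable fun y => F (Fin.cons r y) := hF.comp (measurable_cons_const r)
  rw [lintegral_population m₀ q G hG N r hF, system, Kernel.const_apply,
    lintegral_map ht hs, chainLaw, ← Measure.pi_map_pi fun _ => hc.aemeasurable,
    lintegral_map hr (by fun_prop)]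
  refine lintegral_congr fun z => congrArg F ?_
  ext i k
  obtain rfl : k = 0 := Subsingleton.elim (α := Fin 1) _ _
  induction i using Fin.cases with
  | zero => simp [tracedPath, lineage, withRef]
  | succ i => simp [tracedPath, lineage, withRef]

lemma lintegral_population_succ {n : ℕ} (r : Fin (n + 2) → X)
    {F : (Fin (N + 1) → Fin (n + 2) → X) → ℝ≥0∞} (hF : Measurable F) :
    ∫⁻ ξ, F ξ ∂(population m₀ q G hG N (n + 1) r) =
      ∫⁻ ξ, ∫⁻ y, F (Fin.cons r y) ∂(offspring q (G n) (hG n) N n ξ)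
        ∂(population m₀ q G hG N n fun k => r k.castSucc) := by
  have hr : Measurable fun y => F (Fin.cons r y) := hF.comp (measurable_cons_const r)
  have hm : Measurable fun p : System X N n × ((Fin N → Fin (N + 1)) × (Fin N → X)) =>
      ((Fin.snoc p.1.1 p.2.2, Fin.snoc p.1.2 p.2.1) : System X N (n + 1)) :=
    (measurable_snoc (measurable_fst.comp measurable_fst)
        (measurable_snd.comp measurable_snd)).prodMk
      (measurable_snoc (measurable_snd.comp measurable_fst)
        (measurable_fst.comp measurable_snd))
  have ht : Measurable fun s : System X N (n + 1) => F (tracedPath r s) :=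
    hF.comp (measurable_tracedPath_population.comp measurable_prodMk_left)
  have htm : Measurable fun p : System X N n × ((Fin N → Fin (N + 1)) × (Fin N → X)) =>
      F (tracedPath r
        ((Fin.snoc p.1.1 p.2.2, Fin.snoc p.1.2 p.2.1) : System X N (n + 1))) := ht.comp hm
  rw [lintegral_population m₀ q G hG N r hF, system, Kernel.lintegral_map _ hm _ ht,
    Kernel.lintegral_compProd _ _ _ htm, Kernel.lintegral_comap,
    lintegral_population m₀ q G hG N _ hr.lintegral_kernel]
  refine lintegral_congr fun s => ?_
  rw [lintegral_offspring q _ _ _ hr, step, Kernel.lintegral_comap,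
    Kernel.lintegral_compProd _ _ _ (htm.fun_comp measurable_prodMk_left)]
  have h : (fun i => tracedPath (fun k : Fin (n + 1) => r k.castSucc) s i (Fin.last n)) =
      withRef (r (Fin.last n).castSucc) (s.1 (Fin.last n)) := by
    ext i; rw [tracedPath_last]
  simp only [tracedPath_snoc, tracedPath_last]
  rfl

lemma lintegral_csmc {n : ℕ} (r : Fin (n + 1) → X) {f : (Fin (n + 1) → X) → ℝ≥0∞}
    (hf : Measurable f) :
    ∫⁻ x, f x ∂(csmc m₀ q G hG N n r) =
      ∫⁻ ξ, selectAvg (fun i => ENNReal.ofReal (G n (ξ i (Fin.last n)))) (fun i => f (ξ i))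
        ∂(population m₀ q G hG N n r) := by
  have hGn := hG n
  have hf' : Measurable fun p : (Fin (n + 1) → X) × (System X N n × Fin (N + 1)) =>
      f (tracedPath p.1 p.2.1 p.2.2) := hf.comp measurable_tracedPath
  rw [csmc, Kernel.lintegral_map _ measurable_tracedPath _ hf, Kernel.lintegral_id_prod hf',
    Kernel.lintegral_compProd _ _ _ (hf'.fun_comp measurable_prodMk_left),
    lintegral_population _ _ _ _ _ _ (measurable_selectAvg (by fun_prop) (by fun_prop))]
  refine lintegral_congr fun s => ?_
  rw [finalSelect, Kernel.lintegral_comap, lintegral_select]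
  simp only [tracedPath_last]

end

/-! ### The bias of one selection step -/

/-- Adding the same amount to numerator and denominator moves a fraction below one towards one. -/
lemma ennreal_div_le_add_div_add {u v : ℝ≥0∞} (d : ℝ≥0∞) (huv : u ≤ v) (hv : v ≠ 0)
    (hv' : v ≠ ∞) (hd : d ≠ ∞) : u / v ≤ (u + d) / (v + d) := by
  rw [ENNReal.div_le_iff hv hv', ← ENNReal.mul_div_right_comm,
    ENNReal.le_div_iff_mul_le (by simp [hv]) (by simp [hv', hd])]
  calc u * (v + d) = u * v + u * d := mul_add _ _ _
    _ ≤ u * v + v * d := by gcongr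
    _ = (u + d) * v := by ring

section OneStep

variable {Y : Type*} [MeasurableSpace Y] (μ : Measure Y) [IsProbabilityMeasure μ]
  {w f : Y → ℝ≥0∞} (hw : Measurable w) (hf : Measurable f) {b : ℝ≥0∞} (hwb : ∀ y, w y ≤ b)
  (hf1 : ∀ y, f y ≤ 1)

include hw hwb

/-- For `N + 1` i.i.d. points the normalised weights sum to at most one. Each of them has integral
at least `μ(w)` times that of `(b + ∑ w)⁻¹`, because its own weight in the denominator is at most
`b`. This replaces Jensen's inequality, which goes the wrong way for an inverse. -/
lemma mul_lintegral_inv_le_one (N : ℕ) :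
    (N + 1) * ((∫⁻ y, w y ∂μ) *
      ∫⁻ z, (b + ∑ j, w (z j))⁻¹ ∂(Measure.pi fun _ : Fin N => μ)) ≤ 1 := by
  have hs : ∀ N : ℕ, Measurable fun z : Fin N → Y => ∑ j, w (z j) := fun N =>
    Finset.measurable_sum _ fun j _ => hw.comp (measurable_pi_apply j)
  have hi : ∀ i : Fin (N + 1), (∫⁻ y, w y ∂μ) *
      (∫⁻ z, (b + ∑ j, w (z j))⁻¹ ∂(Measure.pi fun _ : Fin N => μ)) ≤
      ∫⁻ y, w (y i) * (∑ j, w (y j))⁻¹ ∂(Measure.pi fun _ : Fin (N + 1) => μ) := fun i => by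
    rw [lintegral_pi_insertNth μ i (by fun_prop),
      ← lintegral_mul_const _ hw]
    refine lintegral_mono fun x => ?_
    rw [← lintegral_const_mul _ (by fun_prop)]
    refine lintegral_mono fun z => ?_
    rw [Fin.sum_univ_succAbove _ i]
    simp only [Fin.insertNth_apply_same, Fin.insertNth_apply_succAbove]
    gcongr
    exact hwb x
  calc _ = ∑ i : Fin (N + 1), (∫⁻ y, w y ∂μ) *
        ∫⁻ z, (b + ∑ j, w (z j))⁻¹ ∂(Measure.pi fun _ : Fin N => μ) := by simp
    _ ≤ ∑ i : Fin (N + 1), ∫⁻ y, w (y i) * (∑ j, w (y j))⁻¹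
        ∂(Measure.pi fun _ : Fin (N + 1) => μ) := Finset.sum_le_sum fun i _ => hi i
    _ = ∫⁻ y, (∑ i, w (y i)) * (∑ j, w (y j))⁻¹ ∂(Measure.pi fun _ : Fin (N + 1) => μ) := by
      rw [← lintegral_finsetSum _ fun i _ => by fun_prop]
      simp only [Finset.sum_mul]
    _ ≤ ∫⁻ y, 1 ∂(Measure.pi fun _ : Fin (N + 1) => μ) :=
      lintegral_mono fun y => by rw [← div_eq_mul_inv]; exact ENNReal.div_self_le_one
    _ = 1 := by simp

include hf hf1 in
/-- The law of the selected particle among `r, y_1, …, y_N`, with `y_i` i.i.d. of law `μ`, compared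
with the law `w(y) μ(dy) / ∫ w dμ`. -/
lemma lintegral_selectAvg_le (hb : b ≠ 0) (hb' : b ≠ ∞) {α : ℝ≥0∞}
    (hα : b ≤ α * ∫⁻ y, w y ∂μ) (N : ℕ) (r : Y) :
    ∫⁻ y, selectAvg (fun i => w ((Fin.cons r y : Fin (N + 1) → Y) i))
        (fun i => f ((Fin.cons r y : Fin (N + 1) → Y) i)) ∂(Measure.pi fun _ : Fin N => μ) ≤
      (∫⁻ y, w y * f y ∂μ) / (∫⁻ y, w y ∂μ) + α / (N + 1) := by
  have hs : ∀ N : ℕ, Measurable fun z : Fin N → Y => ∑ j, w (z j) := fun N =>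
    Finset.measurable_sum _ fun j _ => hw.comp (measurable_pi_apply j)
  have hinv : ∀ N : ℕ, Measurable fun z : Fin N → Y => (b + ∑ j, w (z j))⁻¹ := fun N =>
    ((hs N).const_add b).inv
  set m := ∫⁻ y, w y ∂μ with hm
  have hm0 : m ≠ 0 := by
    intro h
    rw [h, mul_zero] at hα
    exact hb (le_antisymm hα bot_le)
  have hm1 : m ≠ ∞ := by
    refine ne_top_of_le_ne_top hb' ((lintegral_mono hwb).trans ?_)
    simp
  have key : ∀ N : ℕ, ∫⁻ z, (b + ∑ j, w (z j))⁻¹ ∂(Measure.pi fun _ : Fin N => μ) ≤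
      ((N + 1) * m)⁻¹ := fun N => by
    rw [ENNReal.le_inv_iff_mul_le, mul_comm, mul_assoc]
    exact mul_lintegral_inv_le_one μ hw hwb N
  -- Replace `f r` by one, then raise the weight of `r` to `b` in numerator and denominator: the
  -- dependence on `r` disappears. If all weights vanish, the selected value `f r` is below `b * b⁻¹
  -- = 1`.
  have hpt : ∀ y : Fin N → Y, selectAvg (fun i => w ((Fin.cons r y : Fin (N + 1) → Y) i))
      (fun i => f ((Fin.cons r y : Fin (N + 1) → Y) i)) ≤
      b * (b + ∑ j, w (y j))⁻¹ + ∑ i, w (y i) * f (y i) * (b + ∑ j, w (y j))⁻¹ := fun y => by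
    have hS : ∑ j, w (y j) ≠ ∞ := ENNReal.sum_ne_top.2 fun j _ => ne_top_of_le_ne_top hb' (hwb _)
    by_cases h : ∑ i, w ((Fin.cons r y : Fin (N + 1) → Y) i) = 0
    · rw [selectAvg_of_sum_eq_zero _ h]
      rw [Fin.sum_univ_succ] at h
      simp only [Fin.cons_zero, Fin.cons_succ] at h ⊢
      rw [(add_eq_zero.1 h).2, add_zero, ENNReal.mul_inv_cancel hb hb']
      exact (hf1 r).trans le_self_add
    · rw [selectAvg_of_sum_ne_zero _ h]
      rw [Fin.sum_univ_succ] at h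
      rw [Fin.sum_univ_succ, Fin.sum_univ_succ]
      simp only [Fin.cons_zero, Fin.cons_succ] at h ⊢
      rw [← Finset.sum_mul, ← add_mul, ← div_eq_mul_inv]
      have hr : w r ≠ ∞ := ne_top_of_le_ne_top hb' (hwb r)
      have hB : ∑ i, w (y i) * f (y i) ≤ ∑ i, w (y i) :=
        Finset.sum_le_sum fun i _ => mul_le_of_le_one_right' (hf1 _)
      have hd : w r + (b - w r) = b := add_tsub_cancel_of_le (hwb r)
      calc (w r * f r + ∑ i, w (y i) * f (y i)) / (w r + ∑ i, w (y i))
          ≤ (w r + ∑ i, w (y i) * f (y i)) / (w r + ∑ i, w (y i)) := by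
            gcongr; exact mul_le_of_le_one_right' (hf1 _)
        _ ≤ (w r + ∑ i, w (y i) * f (y i) + (b - w r)) / (w r + ∑ i, w (y i) + (b - w r)) :=
            ennreal_div_le_add_div_add _ (by gcongr) h (by simp [hr, hS])
              (ne_top_of_le_ne_top hb' tsub_le_self)
        _ = _ := by rw [add_right_comm, hd, add_right_comm, hd]
  -- Dropping the weight of `y i` from the denominator makes the remaining factor independent of `y
  -- i`; `key` then applies to `N - 1` points, which gives `N` in the denominator.
  have hterm : ∀ i : Fin N, ∫⁻ y, w (y i) * f (y i) * (b + ∑ j, w (y j))⁻¹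
      ∂(Measure.pi fun _ : Fin N => μ) ≤ (∫⁻ y, w y * f y ∂μ) / (N * m) := fun i => by
    obtain ⟨M, rfl⟩ : ∃ M, N = M + 1 := ⟨N - 1, by have := i.2; omega⟩
    rw [lintegral_pi_insertNth μ i (by fun_prop), div_eq_mul_inv]
    calc _ ≤ ∫⁻ x, w x * f x * ((M + 1) * m)⁻¹ ∂μ := lintegral_mono fun x => by
          refine le_trans ?_ (mul_le_mul_right (key M) _)
          rw [← lintegral_const_mul _ (hinv M)]
          refine lintegral_mono fun z => ?_
          rw [Fin.sum_univ_succAbove _ i]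
          simp only [Fin.insertNth_apply_same, Fin.insertNth_apply_succAbove]
          gcongr
          exact le_add_self
      _ = _ := by rw [lintegral_mul_const _ (by fun_prop)]; push_cast; rfl
  calc _ ≤ ∫⁻ y, b * (b + ∑ j, w (y j))⁻¹ + ∑ i, w (y i) * f (y i) * (b + ∑ j, w (y j))⁻¹
        ∂(Measure.pi fun _ : Fin N => μ) := lintegral_mono hpt
    _ = b * ∫⁻ y, (b + ∑ j, w (y j))⁻¹ ∂(Measure.pi fun _ : Fin N => μ) +
        ∑ i : Fin N, ∫⁻ y, w (y i) * f (y i) * (b + ∑ j, w (y j))⁻¹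
          ∂(Measure.pi fun _ : Fin N => μ) := by
      rw [lintegral_add_left ((hinv N).const_mul b), lintegral_const_mul _ (hinv N),
        lintegral_finsetSum _ fun i _ => by fun_prop]
    _ ≤ α * m * ((N + 1) * m)⁻¹ + ∑ i : Fin N, (∫⁻ y, w y * f y ∂μ) / (N * m) :=
      add_le_add (mul_le_mul' hα (key N)) (Finset.sum_le_sum fun i _ => hterm i)
    _ ≤ α / (N + 1) + (∫⁻ y, w y * f y ∂μ) / m := by
      refine add_le_add (le_of_eq ?_) ?_
      · rw [← div_eq_mul_inv, ENNReal.mul_div_mul_right _ _ hm0 hm1]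
      · rw [Finset.sum_const, Finset.card_univ, Fintype.card_fin, nsmul_eq_mul, ← mul_div_assoc]
        -- The `N` equal terms cancel the `N` in the denominator; for `N = 0` the sum is empty.
        rcases Nat.eq_zero_or_pos N with rfl | hN
        · simp
        · rw [ENNReal.mul_div_mul_left _ _ (by exact_mod_cast hN.ne') (by simp)]
    _ = _ := add_comm _ _

end OneStep

/-! ### Exchangeability of the population and invariance of the target -/

section Invariance

variable (m₀ : Measure X) [IsProbabilityMeasure m₀] (q : Kernel X X) [IsMarkovKernel q]
  (G : ℕ → X → ℝ) (hG : ∀ k, Measurable (G k)) (N : ℕ)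

include hG in
lemma measurable_prod_potential (n : ℕ) : Measurable fun x : Fin (n + 1) → X =>
    ∏ k : Fin n, ENNReal.ofReal (G k (x k.castSucc)) :=
  Finset.measurable_prod _ fun k _ =>
    ENNReal.measurable_ofReal.comp ((hG k).comp (measurable_pi_apply _))

/-- The law of the chain `x_{0:n}` reweighted by `∏_{k < n} G_k(x_k)`, not normalised. -/
def predictive (n : ℕ) : Measure (Fin (n + 1) → X) :=
  (chainLaw m₀ q n).withDensity fun x => ∏ k : Fin n, ENNReal.ofReal (G k (x k.castSucc))

omit [IsProbabilityMeasure m₀] [IsMarkovKernel q] in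
lemma predictive_zero : predictive m₀ q G 0 = chainLaw m₀ q 0 := by
  simp [predictive]

include hG in
lemma lintegral_predictive_succ (n : ℕ) {F : (Fin (n + 2) → X) → ℝ≥0∞} (hF : Measurable F) :
    ∫⁻ x, F x ∂(predictive m₀ q G (n + 1)) =
      ∫⁻ x, ENNReal.ofReal (G n (x (Fin.last n))) * ∫⁻ y, F y ∂(extend q n x)
        ∂(predictive m₀ q G n) := by
  have hW := measurable_prod_potential G hG
  have hGn : Measurable fun x : Fin (n + 1) → X => ENNReal.ofReal (G n (x (Fin.last n))) :=
    ENNReal.measurable_ofReal.comp ((hG n).comp (measurable_pi_apply _))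
  have hF' : Measurable fun x => ENNReal.ofReal (G n (x (Fin.last n))) *
      ∫⁻ y, F y ∂(extend q n x) := hGn.mul hF.lintegral_kernel
  rw [predictive, predictive, lintegral_withDensity_eq_lintegral_mul _ (hW _) hF,
    lintegral_withDensity_eq_lintegral_mul _ (hW _) hF',
    lintegral_chainLaw_succ _ _ _ ((hW _).mul hF)]
  refine lintegral_congr fun x => ?_
  rw [lintegral_extend q x ((hW _).mul hF), Pi.mul_apply, lintegral_extend q x hF, ← mul_assoc,
    ← lintegral_const_mul _ (hF.fun_comp (measurable_snoc measurable_const measurable_id'))]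
  refine lintegral_congr fun t => ?_
  simp [Fin.prod_univ_castSucc, -Fin.castSucc_succ]

/-- The law of the population whose reference path is drawn from the predictive measure. -/
def exchangeableLaw (n : ℕ) : Measure (Fin (N + 1) → Fin (n + 1) → X) :=
  (predictive m₀ q G n).bind (population m₀ q G hG N n)

omit [IsProbabilityMeasure m₀] in
lemma lintegral_exchangeableLaw (n : ℕ) {F : (Fin (N + 1) → Fin (n + 1) → X) → ℝ≥0∞}
    (hF : Measurable F) :
    ∫⁻ ξ, F ξ ∂(exchangeableLaw m₀ q G hG N n) =
      ∫⁻ r, ∫⁻ ξ, F ξ ∂(population m₀ q G hG N n r) ∂(predictive m₀ q G n) :=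
  Measure.lintegral_bind (Kernel.measurable _).aemeasurable hF.aemeasurable

/-- The weighted integral over the offspring of a population and over an additional offspring of
the path with index `j`. -/
def offspringIntegral {n : ℕ} (F : (Fin (N + 1) → Fin (n + 2) → X) → ℝ≥0∞) (j : Fin (N + 1))
    (ξ : Fin (N + 1) → Fin (n + 1) → X) : ℝ≥0∞ :=
  ENNReal.ofReal (G n (ξ j (Fin.last n))) *
    ∫⁻ x, ∫⁻ y, F (Fin.cons x y) ∂(offspring q (G n) (hG n) N n ξ) ∂(extend q n (ξ j))

lemma measurable_lintegral_offspring {n : ℕ} {F : (Fin (N + 1) → Fin (n + 2) → X) → ℝ≥0∞}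
    (hF : Measurable F) :
    Measurable fun p : (Fin (N + 1) → Fin (n + 1) → X) × (Fin (n + 2) → X) =>
      ∫⁻ y, F (Fin.cons p.2 y) ∂(offspring q (G n) (hG n) N n p.1) := by
  have h : Measurable fun s : ((Fin (N + 1) → Fin (n + 1) → X) × (Fin (n + 2) → X)) ×
      (Fin N → Fin (n + 2) → X) => F (Fin.cons s.1.2 s.2) :=
    hF.comp (measurable_cons measurable_snd (measurable_snd.comp measurable_fst))
  exact h.lintegral_kernel_prod_right'
    (κ := (offspring q (G n) (hG n) N n).comap Prod.fst measurable_fst)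

lemma measurable_offspringIntegral {n : ℕ} {F : (Fin (N + 1) → Fin (n + 2) → X) → ℝ≥0∞}
    (hF : Measurable F) (j : Fin (N + 1)) : Measurable (offspringIntegral q G hG N F j) := by
  have hGn := hG n
  refine Measurable.mul (by fun_prop) ?_
  exact (measurable_lintegral_offspring q G hG N hF).lintegral_kernel_prod_right'
    (κ := (extend q n).comap (fun ξ => ξ j) (measurable_pi_apply j))

/-- A predictive path at time `n + 1` is one at time `n`, weighted by `G n` at its endpoint and
extended by `q`, independently of the population at time `n`. So the new reference is an extra
weighted offspring of path `0`. -/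
lemma lintegral_exchangeableLaw_succ (n : ℕ) {F : (Fin (N + 1) → Fin (n + 2) → X) → ℝ≥0∞}
    (hF : Measurable F) :
    ∫⁻ ξ, F ξ ∂(exchangeableLaw m₀ q G hG N (n + 1)) =
      ∫⁻ ξ, offspringIntegral q G hG N F 0 ξ ∂(exchangeableLaw m₀ q G hG N n) := by
  have hoff := measurable_lintegral_offspring q G hG N hF
  rw [lintegral_exchangeableLaw _ _ _ _ _ _ hF, lintegral_exchangeableLaw _ _ _ _ _ _
    (measurable_offspringIntegral q G hG N hF 0),
    lintegral_predictive_succ m₀ q G hG n hF.lintegral_kernel]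
  refine lintegral_congr fun x => ?_
  have hx : Measurable fun ξ : Fin (N + 1) → Fin (n + 1) → X =>
      ∫⁻ x', ∫⁻ y, F (Fin.cons x' y) ∂(offspring q (G n) (hG n) N n ξ) ∂(extend q n x) :=
    hoff.lintegral_prod_right'
  rw [lintegral_population_congr m₀ q G hG N x (measurable_offspringIntegral q G hG N hF 0)
    (hx.const_mul (ENNReal.ofReal (G n (x (Fin.last n)))))
    (fun ξ hξ => by rw [offspringIntegral, hξ]), lintegral_const_mul _ hx]
  congr 1
  rw [lintegral_lintegral_swap (f := fun ξ x' =>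
    ∫⁻ y, F (Fin.cons x' y) ∂(offspring q (G n) (hG n) N n ξ)) hoff.aemeasurable,
    lintegral_extend q x hF.lintegral_kernel, lintegral_extend q x hoff.lintegral_prod_left']
  refine lintegral_congr fun t => ?_
  rw [lintegral_population_succ m₀ q G hG N _ hF]
  simp only [Fin.snoc_castSucc]

/-- The nonvanishing total weight is essential: the convention of selecting index `0` is not
symmetric. -/
lemma mutate_perm (g : X → ℝ) (hg : Measurable g) {n : ℕ} (ξ : Fin (N + 1) → Fin (n + 1) → X)
    (σ : Equiv.Perm (Fin (N + 1))) (h : ∑ i, ENNReal.ofReal (g (ξ i (Fin.last n))) ≠ 0) :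
    mutate q g hg N n (fun i => ξ (σ i)) = mutate q g hg N n ξ := by
  have h1 : ∑ i, ENNReal.ofReal (g (ξ (σ i) (Fin.last n))) =
      ∑ i, ENNReal.ofReal (g (ξ i (Fin.last n))) :=
    Equiv.sum_comp σ fun i => ENNReal.ofReal (g (ξ i (Fin.last n)))
  refine Measure.ext_of_lintegral _ fun F hF => ?_
  rw [lintegral_mutate q g hg _ hF, lintegral_mutate q g hg _ hF,
    selectAvg_of_sum_ne_zero _ h, selectAvg_of_sum_ne_zero _ (h1 ▸ h), h1]
  congr 1
  exact Equiv.sum_comp σ fun i => ENNReal.ofReal (g (ξ i (Fin.last n))) *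
    ∫⁻ y, F y ∂(extend q n (ξ i))

/-- If the total weight vanishes, symmetry of the offspring law fails, but then the prefactor is
zero on both sides. -/
lemma offspringIntegral_swap {n : ℕ} (F : (Fin (N + 1) → Fin (n + 2) → X) → ℝ≥0∞)
    (j : Fin (N + 1)) (ξ : Fin (N + 1) → Fin (n + 1) → X) :
    offspringIntegral q G hG N F 0 (fun i => ξ (Equiv.swap 0 j i)) =
      offspringIntegral q G hG N F j ξ := by
  simp only [offspringIntegral, Equiv.swap_apply_left]
  by_cases h : ∑ i, ENNReal.ofReal (G n (ξ i (Fin.last n))) = 0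
  · rw [Finset.sum_eq_zero_iff.1 h j (Finset.mem_univ j), zero_mul, zero_mul]
  · simp only [offspring_apply, mutate_perm q N (G n) (hG n) ξ _ h]

/-- Summing over the parent of the extra path makes it a draw from `mutate`, up to the total weight,
so it joins the others in a family of `N + 1` i.i.d. paths. -/
lemma sum_offspringIntegral {n : ℕ} {F : (Fin (N + 1) → Fin (n + 2) → X) → ℝ≥0∞}
    (hF : Measurable F) (ξ : Fin (N + 1) → Fin (n + 1) → X) :
    ∑ j, offspringIntegral q G hG N F j ξ =
      (∑ j, ENNReal.ofReal (G n (ξ j (Fin.last n)))) *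
        ∫⁻ y, F y ∂(Measure.pi fun _ : Fin (N + 1) => mutate q (G n) (hG n) N n ξ) := by
  rw [lintegral_pi_insertNth _ 0 hF]
  simp only [Fin.insertNth_zero', ← offspring_apply]
  rw [lintegral_mutate q _ _ ξ
    ((measurable_lintegral_offspring q G hG N hF).fun_comp measurable_prodMk_left),
    sum_mul_selectAvg _ fun _ => ENNReal.ofReal_ne_top]
  rfl

lemma mul_lintegral_eq_lintegral_sum {Y : Type*} [MeasurableSpace Y]
    {Γ : Measure (Fin (N + 1) → Y)}
    (hΓ : ∀ (σ : Equiv.Perm (Fin (N + 1))) (F : (Fin (N + 1) → Y) → ℝ≥0∞), Measurable F →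
      ∫⁻ ξ, F (fun i => ξ (σ i)) ∂Γ = ∫⁻ ξ, F ξ ∂Γ)
    {L : Fin (N + 1) → (Fin (N + 1) → Y) → ℝ≥0∞} (hL : ∀ j, Measurable (L j))
    (hswap : ∀ j ξ, L 0 (fun i => ξ (Equiv.swap 0 j i)) = L j ξ) :
    (N + 1) * ∫⁻ ξ, L 0 ξ ∂Γ = ∫⁻ ξ, ∑ j, L j ξ ∂Γ := by
  have h : ∀ j, ∫⁻ ξ, L j ξ ∂Γ = ∫⁻ ξ, L 0 ξ ∂Γ := fun j => by
    rw [← hΓ (Equiv.swap 0 j) (L 0) (hL 0)]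
    simp only [hswap]
  rw [lintegral_finsetSum _ fun j _ => hL j]
  simp [h]

/-- At time `0` all paths are i.i.d. Inductively, exchangeability at time `n` permits averaging over
the parent of the reference, after which the new paths are a mixture of i.i.d. families. -/
lemma exchangeableLaw_perm : ∀ (n : ℕ) (σ : Equiv.Perm (Fin (N + 1)))
    (F : (Fin (N + 1) → Fin (n + 1) → X) → ℝ≥0∞), Measurable F →
    ∫⁻ ξ, F (fun i => ξ (σ i)) ∂(exchangeableLaw m₀ q G hG N n) =
      ∫⁻ ξ, F ξ ∂(exchangeableLaw m₀ q G hG N n) := by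
  have hσ : ∀ (n : ℕ) (σ : Equiv.Perm (Fin (N + 1))),
      Measurable fun (ξ : Fin (N + 1) → Fin (n + 1) → X) i => ξ (σ i) := fun n σ =>
    measurable_pi_lambda _ fun _ => measurable_pi_apply _
  intro n
  induction n with
  | zero =>
    intro σ F hF
    have h : ∀ F : (Fin (N + 1) → Fin 1 → X) → ℝ≥0∞, Measurable F →
        ∫⁻ ξ, F ξ ∂(exchangeableLaw m₀ q G hG N 0) =
          ∫⁻ y, F y ∂(Measure.pi fun _ : Fin (N + 1) => chainLaw m₀ q 0) := fun F hF => by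
      rw [lintegral_exchangeableLaw _ _ _ _ _ _ hF, predictive_zero,
        lintegral_pi_insertNth _ 0 hF]
      refine lintegral_congr fun r => ?_
      rw [lintegral_population_zero m₀ q G hG N r hF]
      simp only [Fin.insertNth_zero']
    rw [h F hF, h _ (hF.fun_comp (hσ 0 σ))]
    exact lintegral_pi_perm _ σ hF
  | succ n ih =>
    intro σ F hF
    have h : ∀ F : (Fin (N + 1) → Fin (n + 2) → X) → ℝ≥0∞, Measurable F →
        (N + 1) * ∫⁻ ξ, F ξ ∂(exchangeableLaw m₀ q G hG N (n + 1)) =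
          ∫⁻ ξ, (∑ j, ENNReal.ofReal (G n (ξ j (Fin.last n)))) *
            ∫⁻ y, F y ∂(Measure.pi fun _ : Fin (N + 1) => mutate q (G n) (hG n) N n ξ)
            ∂(exchangeableLaw m₀ q G hG N n) := fun F hF => by
      rw [lintegral_exchangeableLaw_succ m₀ q G hG N n hF, mul_lintegral_eq_lintegral_sum N ih
        (measurable_offspringIntegral q G hG N hF) (offspringIntegral_swap q G hG N F)]
      simp only [sum_offspringIntegral q G hG N hF]
    have hN : (N + 1 : ℝ≥0∞) ≠ 0 := by simp
    have hN' : (N + 1 : ℝ≥0∞) ≠ ∞ := by simp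
    refine (ENNReal.mul_right_inj hN hN').1 ?_
    rw [h F hF, h _ (hF.fun_comp (hσ _ σ))]
    refine lintegral_congr fun ξ => ?_
    rw [lintegral_pi_perm _ σ hF]

/-- The conditional SMC kernel leaves the unnormalised target invariant. -/
lemma lintegral_csmc_predictive {n : ℕ} {f : (Fin (n + 1) → X) → ℝ≥0∞} (hf : Measurable f) :
    ∫⁻ r, ENNReal.ofReal (G n (r (Fin.last n))) * ∫⁻ x, f x ∂(csmc m₀ q G hG N n r)
        ∂(predictive m₀ q G n) =
      ∫⁻ r, ENNReal.ofReal (G n (r (Fin.last n))) * f r ∂(predictive m₀ q G n) := by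
  have hGn := hG n
  let w : (Fin (n + 1) → X) → ℝ≥0∞ := fun x => ENNReal.ofReal (G n (x (Fin.last n)))
  have hw : Measurable w := by fun_prop
  let S : (Fin (N + 1) → Fin (n + 1) → X) → ℝ≥0∞ := fun ξ =>
    selectAvg (fun i => w (ξ i)) fun i => f (ξ i)
  have hS : Measurable S := measurable_selectAvg (by fun_prop) (by fun_prop)
  have hL1 : ∀ j : Fin (N + 1), Measurable fun ξ : Fin (N + 1) → Fin (n + 1) → X =>
      w (ξ j) * S ξ := fun j => by fun_prop
  have hL2 : ∀ j : Fin (N + 1), Measurable fun ξ : Fin (N + 1) → Fin (n + 1) → X =>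
      w (ξ j) * f (ξ j) := fun j => by fun_prop
  have h1 : ∫⁻ r, w r * ∫⁻ x, f x ∂(csmc m₀ q G hG N n r) ∂(predictive m₀ q G n) =
      ∫⁻ ξ, w (ξ 0) * S ξ ∂(exchangeableLaw m₀ q G hG N n) := by
    rw [lintegral_exchangeableLaw _ _ _ _ _ _ (hL1 0)]
    refine lintegral_congr fun r => ?_
    rw [lintegral_population_congr m₀ q G hG N r (hL1 0) (hS.const_mul (w r))
      (fun ξ hξ => by rw [hξ]), lintegral_const_mul _ hS, lintegral_csmc m₀ q G hG N r hf]
  have h2 : ∫⁻ r, w r * f r ∂(predictive m₀ q G n) =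
      ∫⁻ ξ, w (ξ 0) * f (ξ 0) ∂(exchangeableLaw m₀ q G hG N n) := by
    rw [lintegral_exchangeableLaw _ _ _ _ _ _ (hL2 0)]
    refine lintegral_congr fun r => ?_
    rw [lintegral_population_congr m₀ q G hG N r (hL2 0)
      (measurable_const (a := w r * f r)) (fun ξ hξ => by rw [hξ])]
    simp
  change ∫⁻ r, w r * ∫⁻ x, f x ∂(csmc m₀ q G hG N n r) ∂(predictive m₀ q G n) =
    ∫⁻ r, w r * f r ∂(predictive m₀ q G n)
  have hN : (N + 1 : ℝ≥0∞) ≠ 0 := by simp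
  have hN' : (N + 1 : ℝ≥0∞) ≠ ∞ := by simp
  have hperm := exchangeableLaw_perm m₀ q G hG N n
  refine (ENNReal.mul_right_inj hN hN').1 ?_
  -- After symmetrisation both integrands equal `∑ j, w (ξ j) * f (ξ j)`.
  rw [h1, h2, mul_lintegral_eq_lintegral_sum N hperm hL2 (by simp),
    mul_lintegral_eq_lintegral_sum N hperm hL1]
  · refine lintegral_congr fun ξ => ?_
    rw [← Finset.sum_mul]
    exact sum_mul_selectAvg _ fun _ => ENNReal.ofReal_ne_top
  · intro j ξ
    simp only [Equiv.swap_apply_left]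
    by_cases h : ∑ i, w (ξ i) = 0
    · rw [Finset.sum_eq_zero_iff.1 h j (Finset.mem_univ j), zero_mul, zero_mul]
    · have h' : ∑ i, w (ξ (Equiv.swap 0 j i)) = ∑ i, w (ξ i) :=
        Equiv.sum_comp (Equiv.swap 0 j) fun i => w (ξ i)
      simp only [S]
      rw [selectAvg_of_sum_ne_zero _ h, selectAvg_of_sum_ne_zero _ (h' ▸ h), h',
        Equiv.sum_comp (Equiv.swap 0 j) fun i => w (ξ i) * f (ξ i)]

end Invariance

/-! ### The bias of the conditional SMC kernel -/

lemma le_selectAvg {N : ℕ} {w v : Fin (N + 1) → ℝ≥0∞} {b : ℝ≥0∞} (hw : ∀ i, w i ≠ ∞)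
    (hb : ∀ i, b ≤ v i) : b ≤ selectAvg w v := by
  by_cases h : ∑ j, w j = 0
  · rw [selectAvg_of_sum_eq_zero v h]; exact hb 0
  · rw [selectAvg_of_sum_ne_zero v h, ENNReal.le_div_iff_mul_le (Or.inl h)
      (Or.inl (ENNReal.sum_ne_top.2 fun i _ => hw i)), mul_comm, Finset.sum_mul]
    exact Finset.sum_le_sum fun i _ => mul_le_mul_right (hb i) _

lemma mul_selectAvg {N : ℕ} (w v : Fin (N + 1) → ℝ≥0∞) (a : ℝ≥0∞) :
    a * selectAvg w v = selectAvg w fun i => a * v i := by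
  by_cases h : ∑ j, w j = 0
  · rw [selectAvg_of_sum_eq_zero _ h, selectAvg_of_sum_eq_zero _ h]
  · rw [selectAvg_of_sum_ne_zero _ h, selectAvg_of_sum_ne_zero _ h, ← mul_div_assoc,
      Finset.mul_sum]
    simp only [mul_left_comm]

/-- Change of weights: a ratio of averages is an average of ratios for tilted weights. As `c` does
not vanish, the two total weights vanish together, and both sides then read index `0`. -/
lemma selectAvg_div {N : ℕ} {g a c : Fin (N + 1) → ℝ≥0∞} (hg : ∀ i, g i ≠ ∞)
    (hc : ∀ i, c i ≠ 0) (hc' : ∀ i, c i ≠ ∞) :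
    selectAvg g a / selectAvg g c = selectAvg (fun i => g i * c i) fun i => a i / c i := by
  by_cases h : ∑ j, g j = 0
  · have h' : ∑ j, g j * c j = 0 :=
      Finset.sum_eq_zero fun j _ => by rw [Finset.sum_eq_zero_iff.1 h j (Finset.mem_univ j), zero_mul]
    rw [selectAvg_of_sum_eq_zero _ h, selectAvg_of_sum_eq_zero _ h, selectAvg_of_sum_eq_zero _ h']
  · have h' : ∑ j, g j * c j ≠ 0 := fun h0 => h <| Finset.sum_eq_zero fun j _ =>
      (mul_eq_zero.1 (Finset.sum_eq_zero_iff.1 h0 j (Finset.mem_univ j))).resolve_right (hc j)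
    have hS : ∑ j, g j ≠ ∞ := ENNReal.sum_ne_top.2 fun i _ => hg i
    rw [selectAvg_of_sum_ne_zero _ h, selectAvg_of_sum_ne_zero _ h, selectAvg_of_sum_ne_zero _ h',
      div_eq_mul_inv (∑ i, g i * a i), div_eq_mul_inv (∑ i, g i * c i),
      ENNReal.mul_div_mul_right _ _ (by simp [hS]) (by simp [h])]
    congr 1
    refine Finset.sum_congr rfl fun i _ => ?_
    rw [mul_assoc, ENNReal.mul_div_cancel (hc i) (hc' i)]

/-- Functions `w_0, …, w_T` with `w_k = G_k q(w_{k+1})` which are bounded by `α` times their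
integral with respect to the law of a new particle. -/
structure BoundedPotential (m₀ : Measure X) (q : Kernel X X) (G : ℕ → X → ℝ) (T : ℕ) (α : ℝ≥0∞)
    (w : ℕ → X → ℝ≥0∞) : Prop where
  measurable : ∀ k ≤ T, Measurable (w k)
  recursion : ∀ k < T, ∀ x, w k x = ENNReal.ofReal (G k x) * ∫⁻ y, w (k + 1) y ∂(q x)
  bound_zero : ∃ b, b ≠ 0 ∧ b ≠ ∞ ∧ (∀ x, w 0 x ≤ b) ∧ b ≤ α * ∫⁻ x, w 0 x ∂m₀
  bound_succ : ∀ k < T, ∃ b, b ≠ 0 ∧ b ≠ ∞ ∧ (∀ x, w (k + 1) x ≤ b) ∧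
    ∀ x, b ≤ α * ∫⁻ y, w (k + 1) y ∂(q x)

section Bias

variable (m₀ : Measure X) [IsProbabilityMeasure m₀] (q : Kernel X X) [IsMarkovKernel q]
  (G : ℕ → X → ℝ) (hG : ∀ k, Measurable (G k)) (N : ℕ) {T : ℕ} {α : ℝ≥0∞} {w : ℕ → X → ℝ≥0∞}

omit [IsProbabilityMeasure m₀] [IsMarkovKernel q] in
lemma lintegral_chainLaw_zero {F : (Fin 1 → X) → ℝ≥0∞} (hF : Measurable F) :
    ∫⁻ x, F x ∂(chainLaw m₀ q 0) = ∫⁻ t, F (fun _ => t) ∂m₀ :=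
  lintegral_map hF (measurable_pi_lambda _ fun _ => measurable_id)

/-- Induction on time, with test function and weight pulled back. Given the population at time `n`,
one selection bias `α / (N + 1)` is paid at time `n + 1`; the main term is again a selection average
at time `n`, for the weight `w n` and the test function `a / c ≤ 1`. -/
lemma lintegral_population_le (hw : BoundedPotential m₀ q G T α w) : ∀ {n : ℕ}, n ≤ T →
    ∀ {f : (Fin (n + 1) → X) → ℝ≥0∞}, Measurable f → (∀ x, f x ≤ 1) → ∀ r : Fin (n + 1) → X,
    ∫⁻ ξ, selectAvg (fun i => w n (ξ i (Fin.last n))) (fun i => f (ξ i))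
        ∂(population m₀ q G hG N n r) ≤
      (∫⁻ x, w n (x (Fin.last n)) * f x ∂(predictive m₀ q G n)) /
        (∫⁻ x, w n (x (Fin.last n)) ∂(predictive m₀ q G n)) + (n + 1) * (α / (N + 1)) := by
  have hwl : ∀ n, n ≤ T → Measurable fun x : Fin (n + 1) → X => w n (x (Fin.last n)) :=
    fun n hn => (hw.measurable n hn).comp (measurable_pi_apply _)
  have hsel : ∀ n, n ≤ T → ∀ f : (Fin (n + 1) → X) → ℝ≥0∞, Measurable f →
      Measurable fun ξ : Fin (N + 1) → Fin (n + 1) → X =>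
        selectAvg (fun i => w n (ξ i (Fin.last n))) fun i => f (ξ i) := fun n hn f hf =>
    measurable_selectAvg
      (measurable_pi_lambda _ fun i => (hwl n hn).comp (measurable_pi_apply i)) (by fun_prop)
  intro n
  induction n with
  | zero =>
    intro hn f hf hf1 r
    have hw0 := hwl 0 hn
    obtain ⟨b, hb, hb', hwb, hα⟩ := hw.bound_zero
    have : IsProbabilityMeasure (chainLaw m₀ q 0) := inferInstance
    rw [lintegral_population_zero m₀ q G hG N r (hsel 0 hn f hf), predictive_zero]
    refine (lintegral_selectAvg_le (chainLaw m₀ q 0) hw0 hf (fun y => hwb _) hf1 hb hb' (α := α)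
      ?_ N r).trans ?_
    · rwa [lintegral_chainLaw_zero m₀ q hw0]
    · simp
  | succ n ih =>
    intro hn f hf hf1 r
    have hw1 := hwl (n + 1) hn
    have hwf : Measurable fun x => w (n + 1) (x (Fin.last (n + 1))) * f x := hw1.mul hf
    obtain ⟨b, hb, hb', hwb, hα⟩ := hw.bound_succ n hn
    set a : (Fin (n + 1) → X) → ℝ≥0∞ := fun x =>
      ∫⁻ y, w (n + 1) (y (Fin.last (n + 1))) * f y ∂(extend q n x) with ha
    set c : (Fin (n + 1) → X) → ℝ≥0∞ := fun x =>
      ∫⁻ y, w (n + 1) (y (Fin.last (n + 1))) ∂(extend q n x) with hc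
    have ham : Measurable a := hwf.lintegral_kernel
    have hcm : Measurable c := hw1.lintegral_kernel
    have hcq : ∀ x, c x = ∫⁻ y, w (n + 1) y ∂(q (x (Fin.last n))) := fun x => by
      rw [hc]; simp only []
      rw [lintegral_extend q x hw1]
      simp only [Fin.snoc_last]
    have hcα : ∀ x, b ≤ α * c x := fun x => by rw [hcq]; exact hα _
    have hc0 : ∀ x, c x ≠ 0 := fun x h => by
      have := hcα x
      rw [h, mul_zero] at this
      exact hb (le_antisymm this bot_le)
    have hct : ∀ x, c x ≠ ∞ := fun x =>
      ne_top_of_le_ne_top hb' ((lintegral_mono fun y => hwb _).trans (by simp))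
    have hac : ∀ x, a x ≤ c x := fun x =>
      lintegral_mono fun y => mul_le_of_le_one_right' (hf1 y)
    have hrec : ∀ x : Fin (n + 1) → X, w n (x (Fin.last n)) =
        ENNReal.ofReal (G n (x (Fin.last n))) * c x := fun x => by
      rw [hw.recursion n hn, hcq]
    have hstep : ∀ ξ : Fin (N + 1) → Fin (n + 1) → X,
        ∫⁻ y, selectAvg
          (fun i => w (n + 1) ((Fin.cons r y : Fin (N + 1) → _) i (Fin.last (n + 1))))
          (fun i => f ((Fin.cons r y : Fin (N + 1) → _) i))
          ∂(offspring q (G n) (hG n) N n ξ) ≤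
        selectAvg (fun i => w n (ξ i (Fin.last n))) (fun i => a (ξ i) / c (ξ i)) +
          α / (N + 1) := fun ξ => by
      refine (lintegral_selectAvg_le (mutate q (G n) (hG n) N n ξ) hw1 hf (fun y => hwb _) hf1
        hb hb' (α := α) ?_ N r).trans ?_
      -- The lower bound holds from every starting point, hence for every selection average,
      -- whatever the population.
      · rw [lintegral_mutate q _ _ ξ hw1, mul_selectAvg]
        exact le_selectAvg (fun _ => ENNReal.ofReal_ne_top) fun i => hcα (ξ i)
      · rw [lintegral_mutate q _ _ ξ hw1, lintegral_mutate q _ _ ξ hwf,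
          selectAvg_div (fun _ => ENNReal.ofReal_ne_top) (fun i => hc0 (ξ i)) fun i => hct (ξ i)]
        simp only [hrec]
        rfl
    have hM : Measurable fun ξ : Fin (N + 1) → Fin (n + 1) → X =>
        selectAvg (fun i => w n (ξ i (Fin.last n))) fun i => a (ξ i) / c (ξ i) :=
      hsel n (by omega) (fun x => a x / c x) (by fun_prop)
    rw [lintegral_population_succ m₀ q G hG N r (hsel _ hn f hf)]
    refine (lintegral_mono hstep).trans ?_
    rw [lintegral_add_left hM, lintegral_const, measure_univ, mul_one]
    refine (add_le_add_left (ih (by omega) (f := fun x => a x / c x) (by fun_prop)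
      (fun x => ENNReal.div_le_of_le_mul (by rw [one_mul]; exact hac x)) _) _).trans ?_
    rw [lintegral_predictive_succ m₀ q G hG n hwf, lintegral_predictive_succ m₀ q G hG n hw1]
    simp only [hrec]
    have h1 : ∀ x : Fin (n + 1) → X, ENNReal.ofReal (G n (x (Fin.last n))) * c x * (a x / c x) =
        ENNReal.ofReal (G n (x (Fin.last n))) * a x := fun x => by
      rw [mul_assoc, ENNReal.mul_div_cancel (hc0 x) (hct x)]
    simp only [h1]
    refine le_of_eq ?_
    push_cast
    ring

include hG in
-- The recursion makes this integral constant in time. At the final time it is the normalising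
-- constant of the target, which is thereby positive and finite.
lemma lintegral_predictive_potential (hw : BoundedPotential m₀ q G T α w) : ∀ {n : ℕ}, n ≤ T →
    ∫⁻ x, w n (x (Fin.last n)) ∂(predictive m₀ q G n) = ∫⁻ x, w 0 x ∂m₀ := by
  have hwl : ∀ n, n ≤ T → Measurable fun x : Fin (n + 1) → X => w n (x (Fin.last n)) :=
    fun n hn => (hw.measurable n hn).comp (measurable_pi_apply _)
  intro n
  induction n with
  | zero =>
    intro hn
    rw [predictive_zero, lintegral_chainLaw_zero m₀ q (hwl 0 hn)]
  | succ n ih =>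
    intro hn
    rw [← ih (by omega), lintegral_predictive_succ m₀ q G hG n (hwl _ hn)]
    refine lintegral_congr fun x => ?_
    rw [hw.recursion n hn, lintegral_extend q x (hwl _ hn)]
    simp only [Fin.snoc_last]

include hG in
omit [IsProbabilityMeasure m₀] [IsMarkovKernel q] in
lemma lintegral_target (hG0 : ∀ k x, 0 ≤ G k x) (n : ℕ) {f : (Fin (n + 1) → X) → ℝ≥0∞}
    (hf : Measurable f) :
    ∫⁻ x, f x ∂(target m₀ q G n) =
      (∫⁻ x, ENNReal.ofReal (G n (x (Fin.last n))) * f x ∂(predictive m₀ q G n)) /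
        ∫⁻ x, ENNReal.ofReal (G n (x (Fin.last n))) ∂(predictive m₀ q G n) := by
  have hGn : Measurable fun x : Fin (n + 1) → X => ENNReal.ofReal (G n (x (Fin.last n))) :=
    ENNReal.measurable_ofReal.comp ((hG n).comp (measurable_pi_apply _))
  have h : ((chainLaw m₀ q n).withDensity fun x =>
      ENNReal.ofReal (∏ k : Fin (n + 1), G k (x k))) =
      (predictive m₀ q G n).withDensity fun x => ENNReal.ofReal (G n (x (Fin.last n))) := by
    rw [predictive, ← withDensity_mul _ (measurable_prod_potential G hG n) hGn]
    congr 1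
    ext x
    rw [ENNReal.ofReal_prod_of_nonneg fun k _ => hG0 _ _, Fin.prod_univ_castSucc]
    rfl
  rw [target]
  simp only [h]
  rw [lintegral_smul_measure, lintegral_withDensity_eq_lintegral_mul _ hGn hf,
    withDensity_apply _ MeasurableSet.univ, Measure.restrict_univ, smul_eq_mul,
    ENNReal.div_eq_inv_mul]
  rfl

end Bias

/-! ### The functions `p_{k+1:n}` -/

section FutureWeight

variable (q : Kernel X X) [IsMarkovKernel q] (G : ℕ → X → ℝ) (hG : ∀ k, Measurable (G k))
  (hG0 : ∀ k x, 0 ≤ G k x) {a : ℝ} (ha : ∀ k x, G k x ≤ a)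

include hG in
omit [IsMarkovKernel q] in
lemma measurable_futureWeight : ∀ k j, Measurable (futureWeight q G k j)
  | _, 0 => measurable_const
  | k, j + 1 =>
    (StronglyMeasurable.integral_kernel
      ((hG (k + 1)).mul (measurable_futureWeight (k + 1) j)).stronglyMeasurable).measurable

include hG0 in
omit [IsMarkovKernel q] in
lemma futureWeight_nonneg : ∀ k j x, 0 ≤ futureWeight q G k j x
  | _, 0, _ => zero_le_one
  | k, j + 1, _ => integral_nonneg fun y => mul_nonneg (hG0 _ y) (futureWeight_nonneg (k + 1) j y)

include hG0 ha in
lemma futureWeight_le_pow : ∀ k j x, futureWeight q G k j x ≤ a ^ j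
  | _, 0, _ => by simp [futureWeight]
  | k, j + 1, x => by
    have h : ∀ y, G (k + 1) y * futureWeight q G (k + 1) j y ≤ a ^ (j + 1) := fun y => by
      rw [pow_succ']
      exact mul_le_mul (ha _ y) (futureWeight_le_pow (k + 1) j y)
        (futureWeight_nonneg q G hG0 _ _ _) ((hG0 (k + 1) y).trans (ha _ y))
    calc ∫ y, G (k + 1) y * futureWeight q G (k + 1) j y ∂(q x) ≤ ∫ _, a ^ (j + 1) ∂(q x) :=
          integral_mono_of_nonneg
            (ae_of_all _ fun y => mul_nonneg (hG0 _ y) (futureWeight_nonneg q G hG0 _ _ y))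
            (integrable_const _) (ae_of_all _ h)
      _ = a ^ (j + 1) := by simp

include hG hG0 ha in
lemma integrable_mul_futureWeight (μ : Measure X) [IsProbabilityMeasure μ] (k j : ℕ) :
    Integrable (fun y => G k y * futureWeight q G k j y) μ := by
  refine Integrable.of_bound
    ((hG k).mul (measurable_futureWeight q G hG k j)).aestronglyMeasurable (a * a ^ j)
    (ae_of_all _ fun y => ?_)
  rw [Real.norm_of_nonneg (mul_nonneg (hG0 _ y) (futureWeight_nonneg q G hG0 _ _ y))]
  exact mul_le_mul (ha _ y) (futureWeight_le_pow q G hG0 ha k j y)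
    (futureWeight_nonneg q G hG0 _ _ _) ((hG0 k y).trans (ha k y))

omit [IsMarkovKernel q] in
lemma pFuture_self (n : ℕ) (x : X) : pFuture q G n n x = 1 := by
  simp [pFuture, futureWeight]

omit [IsMarkovKernel q] in
lemma pFuture_of_lt {k n : ℕ} (h : k < n) (x : X) :
    pFuture q G k n x = ∫ y, G (k + 1) y * pFuture q G (k + 1) n y ∂(q x) := by
  obtain ⟨j, rfl⟩ := Nat.exists_eq_add_of_lt h
  have h1 : k + j + 1 - k = j + 1 := by omega
  have h2 : k + j + 1 - (k + 1) = j := by omega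
  simp only [pFuture, h1, h2, futureWeight]

end FutureWeight

/-! ### Consequences of (A1), (A2) and admissibility -/

section Assumptions

variable {m₀ : Measure X} [IsProbabilityMeasure m₀] {q : Kernel X X} [IsMarkovKernel q]
  {G : ℕ → X → ℝ} (hG : ∀ k, Measurable (G k)) (hG0 : ∀ k x, 0 ≤ G k x) {g a : ℝ} (hg : 0 < g)
  (hA1 : ∀ n k, k < n → ∀ x x', g ≤ pFuture q G k n x / pFuture q G k n x' ∧
    pFuture q G k n x / pFuture q G k n x' ≤ g⁻¹)
  (ha : ∀ k x, G k x ≤ a)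

include hG0 hg hA1 in
omit [IsMarkovKernel q] in
-- A zero value would give the ratio `0 / 0 = 0`, which is below `g`.
lemma pFuture_pos {k n : ℕ} (h : k < n) (x : X) : 0 < pFuture q G k n x := by
  refine lt_of_le_of_ne (futureWeight_nonneg q G hG0 k (n - k) x) fun h0 => ?_
  have := (hA1 n k h x x).1
  rw [← h0, div_zero] at this
  linarith

include hG0 hg hA1 in
omit [IsMarkovKernel q] in
lemma le_one_of_ratio_bound [Nonempty X] : g ≤ 1 := by
  obtain ⟨x⟩ := ‹Nonempty X›
  have := (hA1 1 0 one_pos x x).1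
  rwa [div_self (pFuture_pos hG0 hg hA1 one_pos x).ne'] at this

include hG0 hg hA1 in
omit [IsMarkovKernel q] in
/-- The oscillation of `p_{k+1:n}`: up to a factor `g`, it equals its supremum. -/
lemma exists_pFuture_bounds [Nonempty X] {k n : ℕ} (h : k ≤ n) :
    ∃ U, 0 < U ∧ ∀ x, g * U ≤ pFuture q G k n x ∧ pFuture q G k n x ≤ U := by
  rcases h.eq_or_lt with rfl | h
  · exact ⟨1, one_pos, fun x => by
      simp [pFuture_self, le_one_of_ratio_bound hG0 hg hA1]⟩
  · have hle : ∀ x x', pFuture q G k n x ≤ g⁻¹ * pFuture q G k n x' := fun x x' =>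
      (div_le_iff₀ (pFuture_pos hG0 hg hA1 h x')).1 (hA1 n k h x x').2
    obtain ⟨x₀⟩ := ‹Nonempty X›
    have hbdd : BddAbove (Set.range (pFuture q G k n)) :=
      ⟨g⁻¹ * pFuture q G k n x₀, by rintro _ ⟨x, rfl⟩; exact hle x x₀⟩
    have : Nonempty X := ⟨x₀⟩
    refine ⟨⨆ x, pFuture q G k n x,
      (pFuture_pos hG0 hg hA1 h x₀).trans_le (le_ciSup hbdd x₀), fun x => ⟨?_, le_ciSup hbdd x⟩⟩
    rw [mul_comm, ← le_div_iff₀ hg, div_eq_inv_mul]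
    exact ciSup_le fun y => hle y x

include hG0 hg hA1 in
omit [IsMarkovKernel q] in
-- The integral of `G (n + 1)` against `q x` is `p_{n+1:n+1}(x)`, which (A1) bounds away from zero.
-- The maximum collects the finitely many constants; the factors `2` make the inequalities strict.
lemma exists_potentialBound (hm : 0 < ∫ x, G 0 x ∂m₀) (n : ℕ) :
    ∃ c, PotentialBound m₀ q G n c := by
  have : Nonempty X := nonempty_of_isProbabilityMeasure m₀
  induction n with
  | zero =>
    refine ⟨2 * (∫ x, G 0 x ∂m₀)⁻¹, by positivity, ?_, fun k h1 h2 => by omega⟩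
    rw [mul_inv, inv_inv]
    linarith
  | succ n ih =>
    obtain ⟨c, hc, hc0, hck⟩ := ih
    obtain ⟨U, hU, hUp⟩ := exists_pFuture_bounds hG0 hg hA1 n.le_succ
    have hgU : 0 < g * U := mul_pos hg hU
    have hmax : ∀ {t}, c⁻¹ < t → (max c (2 * (g * U)⁻¹))⁻¹ < t := fun h =>
      (inv_anti₀ hc (le_max_left _ _)).trans_lt h
    refine ⟨max c (2 * (g * U)⁻¹), lt_max_of_lt_left hc, hmax hc0, fun k h1 h2 x => ?_⟩
    rcases h2.eq_or_lt with rfl | h2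
    · have h := (hUp x).1
      rw [pFuture_of_lt q G n.lt_succ_self] at h
      simp only [Nat.succ_eq_add_one, pFuture_self, mul_one] at h
      refine lt_of_lt_of_le ?_ h
      refine (inv_anti₀ (by positivity) (le_max_right _ _)).trans_lt ?_
      rw [mul_inv, inv_inv]
      linarith
    · exact hmax (hck k h1 (by omega) x)

include hG hG0 hg ha in
omit [IsMarkovKernel q] in
-- Origin of the constant: `G_k p_{k+1:T}` is at most `a U`, its integral at least `g U c⁻¹`, and `a
-- c g⁻¹` is the quotient. The unknown scale `U` cancels.
lemma le_mul_lintegral_potential [IsMarkovKernel q] (μ : Measure X) [IsProbabilityMeasure μ]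
    {k T : ℕ} {U c : ℝ} (hU : 0 < U) (hUp : ∀ x, g * U ≤ pFuture q G k T x) (hc : 0 < c)
    (ha0 : 0 < a) (hμ : c⁻¹ < ∫ x, G k x ∂μ) :
    ENNReal.ofReal (a * U) ≤ ENNReal.ofReal (a * c * g⁻¹) *
      ∫⁻ x, ENNReal.ofReal (G k x * pFuture q G k T x) ∂μ := by
  have hint := integrable_mul_futureWeight q G hG hG0 ha μ k (T - k)
  have hGint : Integrable (G k) μ := Integrable.of_bound (hG k).aestronglyMeasurable a
    (ae_of_all _ fun y => by rw [Real.norm_of_nonneg (hG0 k y)]; exact ha k y)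
  rw [← ofReal_integral_eq_lintegral_ofReal (f := fun x => G k x * pFuture q G k T x) hint
    (ae_of_all _ fun y => mul_nonneg (hG0 _ y) (futureWeight_nonneg q G hG0 _ _ y)),
    ← ENNReal.ofReal_mul (by positivity)]
  refine ENNReal.ofReal_le_ofReal ?_
  have h1 : ∫ x, G k x * (g * U) ∂μ ≤ ∫ x, G k x * pFuture q G k T x ∂μ :=
    integral_mono (hGint.mul_const _) hint fun x => mul_le_mul_of_nonneg_left (hUp x) (hG0 k x)
  rw [integral_mul_const] at h1
  calc a * U = a * c * g⁻¹ * (c⁻¹ * (g * U)) := by field_simp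
    _ ≤ a * c * g⁻¹ * ∫ x, G k x * pFuture q G k T x ∂μ := by
      gcongr
      exact (mul_le_mul_of_nonneg_right hμ.le (by positivity)).trans h1

include hG hG0 hg hA1 ha in
lemma boundedPotential (ha0 : 0 < a) {T : ℕ} {c : ℝ} (hc : PotentialBound m₀ q G T c) :
    BoundedPotential m₀ q G T (ENNReal.ofReal (a * c * g⁻¹))
      fun k x => ENNReal.ofReal (G k x * pFuture q G k T x) := by
  have : Nonempty X := nonempty_of_isProbabilityMeasure m₀
  obtain ⟨hc, hc0, hck⟩ := hc
  have hb : ∀ {k} {U : ℝ}, 0 < U → (∀ x, g * U ≤ pFuture q G k T x ∧ pFuture q G k T x ≤ U) →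
      ∀ x, ENNReal.ofReal (G k x * pFuture q G k T x) ≤ ENNReal.ofReal (a * U) :=
    fun {k U} hU h x => ENNReal.ofReal_le_ofReal
      (mul_le_mul (ha k x) (h x).2 (futureWeight_nonneg q G hG0 _ _ x) ha0.le)
  refine ⟨fun k _ => ENNReal.measurable_ofReal.comp
    ((hG k).mul (measurable_futureWeight q G hG k (T - k))), fun k hk x => ?_, ?_, fun k hk => ?_⟩
  · rw [ENNReal.ofReal_mul (hG0 k x), pFuture_of_lt q G hk,
      ofReal_integral_eq_lintegral_ofReal (f := fun y => G (k + 1) y * pFuture q G (k + 1) T y)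
        (integrable_mul_futureWeight q G hG hG0 ha (q x) (k + 1) (T - (k + 1)))
        (ae_of_all _ fun y => mul_nonneg (hG0 _ y) (futureWeight_nonneg q G hG0 _ _ y))]
  · obtain ⟨U, hU, hUp⟩ := exists_pFuture_bounds hG0 hg hA1 T.zero_le
    exact ⟨_, by simp only [ne_eq, ENNReal.ofReal_eq_zero, not_le]; positivity,
      ENNReal.ofReal_ne_top, hb hU hUp,
      le_mul_lintegral_potential hG hG0 hg ha m₀ hU (fun x => (hUp x).1) hc ha0 hc0⟩
  · obtain ⟨U, hU, hUp⟩ := exists_pFuture_bounds hG0 hg hA1 (Nat.succ_le_of_lt hk)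
    exact ⟨_, by simp only [ne_eq, ENNReal.ofReal_eq_zero, not_le]; positivity,
      ENNReal.ofReal_ne_top, hb hU hUp, fun x =>
      le_mul_lintegral_potential hG hG0 hg ha (q x) hU (fun x => (hUp x).1) hc ha0
        (hck _ (by omega) hk x)⟩

end Assumptions

/-! ### From the one-step bias to the iterates -/

section Iterates

variable {Y : Type*} [MeasurableSpace Y]

lemma integrable_of_abs_le {μ : Measure Y} [IsProbabilityMeasure μ] {f : Y → ℝ}
    (hf : Measurable f) {M : ℝ} (hM : ∀ x, |f x| ≤ M) : Integrable f μ :=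
  Integrable.of_bound hf.aestronglyMeasurable M (ae_of_all _ hM)

/-- A one-sided bound for functions into `[0, 1]` suffices: apply it to `(1 + f) / 2` and `(1 - f) /
2`. The rescaling costs the factor `2`. -/
lemma abs_integral_sub_integral_le {μ ν : Measure Y} [IsProbabilityMeasure μ]
    [IsProbabilityMeasure ν] {δ : ℝ} (hδ : 0 ≤ δ)
    (h : ∀ F : Y → ℝ≥0∞, Measurable F → (∀ x, F x ≤ 1) →
      ∫⁻ x, F x ∂μ ≤ ∫⁻ x, F x ∂ν + ENNReal.ofReal δ)
    {f : Y → ℝ} (hf : Measurable f) (hf1 : ∀ x, |f x| ≤ 1) :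
    |∫ x, f x ∂μ - ∫ x, f x ∂ν| ≤ 2 * δ := by
  have key : ∀ f : Y → ℝ, Measurable f → (∀ x, |f x| ≤ 1) →
      ∫ x, f x ∂μ ≤ ∫ x, f x ∂ν + 2 * δ := fun f hf hf1 => by
    have hnn : ∀ x, 0 ≤ (1 + f x) / 2 := fun x => by linarith [neg_le_of_abs_le (hf1 x)]
    have hint : ∀ (ρ : Measure Y) [IsProbabilityMeasure ρ], ∫ x, (1 + f x) / 2 ∂ρ =
        (1 + ∫ x, f x ∂ρ) / 2 := fun ρ _ => by
      rw [integral_div, integral_add (integrable_const _) (integrable_of_abs_le hf hf1)]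
      simp
    have hi : ∀ (ρ : Measure Y) [IsProbabilityMeasure ρ],
        ∫⁻ x, ENNReal.ofReal ((1 + f x) / 2) ∂ρ = ENNReal.ofReal ((1 + ∫ x, f x ∂ρ) / 2) :=
      fun ρ _ => by
        rw [← hint ρ]
        exact (ofReal_integral_eq_lintegral_ofReal
          (((integrable_const _).add (integrable_of_abs_le hf hf1)).div_const _)
          (ae_of_all _ hnn)).symm
    have h0 : 0 ≤ (1 + ∫ x, f x ∂ν) / 2 := by rw [← hint ν]; exact integral_nonneg hnn
    have h1 := h (fun x => ENNReal.ofReal ((1 + f x) / 2)) (by fun_prop) fun x =>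
      ENNReal.ofReal_le_one.2 (by linarith [le_of_abs_le (hf1 x)])
    rw [hi, hi, ← ENNReal.ofReal_add h0 hδ, ENNReal.ofReal_le_ofReal_iff (by positivity)] at h1
    linarith
  have h2 := key (fun x => -f x) hf.neg (by simpa using hf1)
  rw [integral_neg, integral_neg] at h2
  rw [abs_le]
  constructor <;> linarith [key f hf hf1]

variable {P : Kernel Y Y} [IsMarkovKernel P] {π : Measure Y} [IsProbabilityMeasure π]

omit [IsMarkovKernel P] [IsProbabilityMeasure π] in
lemma integral_integral_of_invariant
    (hinv : ∀ F : Y → ℝ≥0∞, Measurable F → ∫⁻ y, ∫⁻ x, F x ∂(P y) ∂π = ∫⁻ y, F y ∂π)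
    {f : Y → ℝ} (hf : Integrable f π) : ∫ y, ∫ x, f x ∂(P y) ∂π = ∫ y, f y ∂π := by
  have h : (P ∘ₖ Kernel.const Unit π) () = π := Measure.ext_of_lintegral _ fun F hF => by
    rw [Kernel.lintegral_comp _ _ _ hF, Kernel.const_apply, hinv F hF]
  have h2 := Kernel.integral_comp (η := P) (κ := Kernel.const Unit π) (a := ()) (f := f)
    (by rwa [h])
  rw [h, Kernel.const_apply] at h2
  exact h2.symm

lemma isMarkovKernel_pow (m : ℕ) : IsMarkovKernel (P ^ m) := by
  induction m with
  | zero => rw [pow_zero]; exact inferInstanceAs (IsMarkovKernel Kernel.id)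
  | succ m ih => rw [pow_succ']; exact inferInstanceAs (IsMarkovKernel (P ∘ₖ (P ^ m)))

lemma integral_pow_succ (m : ℕ) (r : Y) {f : Y → ℝ} (hf : Measurable f) {M : ℝ}
    (hM : ∀ x, |f x| ≤ M) :
    ∫ x, f x ∂((P ^ (m + 1)) r) = ∫ y, ∫ x, f x ∂((P ^ m) y) ∂(P r) := by
  have := isMarkovKernel_pow (P := P) (m + 1)
  rw [pow_succ] at this ⊢
  exact Kernel.integral_comp (η := P ^ m) (κ := P) (integrable_of_abs_le hf hM)

variable (hinv : ∀ F : Y → ℝ≥0∞, Measurable F → ∫⁻ y, ∫⁻ x, F x ∂(P y) ∂π = ∫⁻ y, F y ∂π)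
  {ρ : ℝ} (hP : ∀ f : Y → ℝ, Measurable f → (∀ x, |f x| ≤ 1) → ∀ r,
    |∫ x, f x ∂(P r) - ∫ x, f x ∂π| ≤ ρ)

lemma abs_integral_le_of_abs_le {μ : Measure Y} [IsProbabilityMeasure μ] {f : Y → ℝ} {M : ℝ}
    (hM : ∀ x, |f x| ≤ M) : |∫ x, f x ∂μ| ≤ M := by
  simpa using norm_integral_le_of_norm_le_const (μ := μ) (f := f) (ae_of_all _ hM)

include hinv in
lemma integral_integral_pow (m : ℕ) {f : Y → ℝ} (hf : Measurable f) {M : ℝ}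
    (hM : ∀ x, |f x| ≤ M) : ∫ y, ∫ x, f x ∂((P ^ m) y) ∂π = ∫ y, f y ∂π := by
  have hm := isMarkovKernel_pow (P := P)
  induction m with
  | zero =>
    refine integral_congr_ae (ae_of_all _ fun y => ?_)
    change ∫ x, f x ∂(Kernel.id y) = f y
    rw [Kernel.id_apply, integral_dirac' _ _ hf.stronglyMeasurable]
  | succ m ih =>
    simp only [integral_pow_succ m _ hf hM]
    rw [integral_integral_of_invariant hinv, ih]
    exact integrable_of_abs_le hf.stronglyMeasurable.integral_kernel.measurable
      fun y => abs_integral_le_of_abs_le hM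

include hP in
omit [IsMarkovKernel P] [IsProbabilityMeasure π] in
lemma abs_integral_sub_le_mul {h : Y → ℝ} (hh : Measurable h) {M : ℝ}
    (hM : ∀ x, |h x| ≤ M) (r : Y) : |∫ x, h x ∂(P r) - ∫ x, h x ∂π| ≤ ρ * M := by
  have hM0 : 0 ≤ M := (abs_nonneg _).trans (hM r)
  rcases hM0.eq_or_lt with rfl | hM0
  · have : h = 0 := funext fun x => abs_nonpos_iff.1 (hM x)
    simp [this]
  · have := hP (fun x => h x / M) (hh.div_const M) (fun x => by
      rw [abs_div, abs_of_pos hM0]; exact (div_le_one hM0).2 (hM x)) r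
    rwa [integral_div, integral_div, ← sub_div, abs_div, abs_of_pos hM0, div_le_iff₀ hM0] at this

include hinv hP in
-- The centred function `h = P ^ (m + 1) f - π f` is bounded by the previous power of `ρ` and has
-- `π`-integral zero by invariance, so one more iteration gains a factor `ρ`.
lemma abs_integral_pow_sub_le_pow (m : ℕ) {f : Y → ℝ} (hf : Measurable f)
    (hf1 : ∀ x, |f x| ≤ 1) (r : Y) :
    |∫ x, f x ∂((P ^ (m + 1)) r) - ∫ x, f x ∂π| ≤ ρ ^ (m + 1) := by
  have hmk := isMarkovKernel_pow (P := P)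
  induction m generalizing r with
  | zero => simpa using hP f hf hf1 r
  | succ m ih =>
    set h : Y → ℝ := fun y => ∫ x, f x ∂((P ^ (m + 1)) y) - ∫ x, f x ∂π with hh
    have hKm : Measurable fun y => ∫ x, f x ∂((P ^ (m + 1)) y) :=
      hf.stronglyMeasurable.integral_kernel.measurable
    have hKi : ∀ (μ : Measure Y) [IsProbabilityMeasure μ],
        Integrable (fun y => ∫ x, f x ∂((P ^ (m + 1)) y)) μ := fun μ _ =>
      integrable_of_abs_le hKm fun y => abs_integral_le_of_abs_le hf1
    have h1 := abs_integral_sub_le_mul hP (hKm.sub_const _) ih r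
    rw [integral_sub (hKi _) (integrable_const _), integral_sub (hKi _) (integrable_const _),
      integral_integral_pow hinv _ hf hf1, ← integral_pow_succ _ _ hf hf1] at h1
    simpa [pow_succ'] using h1

include hinv hP in
-- Only the first iteration is estimated; the others are absorbed into the test function `P ^ m f`.
lemma abs_integral_pow_sub_le (m : ℕ) {f : Y → ℝ} (hf : Measurable f)
    (hf1 : ∀ x, |f x| ≤ 1) (r : Y) :
    |∫ x, f x ∂((P ^ (m + 1)) r) - ∫ x, f x ∂π| ≤ ρ := by
  have hmk := isMarkovKernel_pow (P := P)
  rw [integral_pow_succ m r hf hf1, ← integral_integral_pow hinv m hf hf1]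
  exact hP _ hf.stronglyMeasurable.integral_kernel.measurable
    (fun y => abs_integral_le_of_abs_le hf1) r

end Iterates

/-! ### Total variation bounds for the conditional SMC kernel -/

/-- The excesses of `n`, `N` and `A` over one are nonnegative, and in terms of them the numerator of
the difference has nonnegative coefficients. -/
lemma bias_le_rate {n N A : ℝ} (hn : 1 ≤ n) (hN : 1 ≤ N) (hA : 1 ≤ A) :
    2 * ((n + 1) * A / (N + 1)) ≤
      (2 * (n + 1) * A - 1) / (N - 1 + 2 * A) + n * A ^ 2 / N := by
  obtain ⟨t, ht, rfl⟩ : ∃ t, 0 ≤ t ∧ A = 1 + t := ⟨A - 1, by linarith, by ring⟩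
  obtain ⟨s, hs, rfl⟩ : ∃ s, 0 ≤ s ∧ N = 1 + s := ⟨N - 1, by linarith, by ring⟩
  obtain ⟨u, hu, rfl⟩ : ∃ u, 0 ≤ u ∧ n = 1 + u := ⟨n - 1, by linarith, by ring⟩
  have hD : 0 < 1 + s - 1 + 2 * (1 + t) := by linarith
  have h1 : 0 < 1 + s := by linarith
  have h2 : 0 < 1 + s + 1 := by linarith
  rw [← sub_nonneg]
  have h : (2 * (1 + u + 1) * (1 + t) - 1) / (1 + s - 1 + 2 * (1 + t)) +
      (1 + u) * (1 + t) ^ 2 / (1 + s) - 2 * ((1 + u + 1) * (1 + t) / (1 + s + 1)) =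
      ((2 * (1 + u + 1) * (1 + t) - 1) * (1 + s) * (1 + s + 1) +
        (1 + u) * (1 + t) ^ 2 * (1 + s - 1 + 2 * (1 + t)) * (1 + s + 1) -
        2 * ((1 + u + 1) * (1 + t)) * (1 + s - 1 + 2 * (1 + t)) * (1 + s)) /
      ((1 + s - 1 + 2 * (1 + t)) * (1 + s) * (1 + s + 1)) := by
    field_simp
  rw [h]
  refine div_nonneg ?_ (by positivity)
  ring_nf
  positivity

section Main

variable {m₀ : Measure X} [IsProbabilityMeasure m₀] {q : Kernel X X} [IsMarkovKernel q]
  {G : ℕ → X → ℝ} (hG : ∀ k, Measurable (G k)) (hG0 : ∀ k x, 0 ≤ G k x) {g a : ℝ} (hg : 0 < g)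
  (hA1 : ∀ n k, k < n → ∀ x x', g ≤ pFuture q G k n x / pFuture q G k n x' ∧
    pFuture q G k n x / pFuture q G k n x' ≤ g⁻¹)
  (ha : ∀ k x, G k x ≤ a) (ha0 : 0 < a) {n : ℕ} {c : ℝ} (hc : PotentialBound m₀ q G n c)

include hG hG0 hg hA1 ha ha0 hc

lemma isProbabilityMeasure_target : IsProbabilityMeasure (target m₀ q G n) := by
  have hw := boundedPotential hG hG0 hg hA1 ha ha0 hc
  obtain ⟨b, hb, hb', hwb, hα⟩ := hw.bound_zero
  have hD := lintegral_predictive_potential m₀ q G hG hw le_rfl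
  simp only [pFuture_self, mul_one] at hD
  refine ⟨?_⟩
  rw [← lintegral_one, lintegral_target m₀ q G hG hG0 n measurable_const]
  simp only [mul_one, hD]
  refine ENNReal.div_self (fun h => ?_)
    (ne_top_of_le_ne_top hb' ((lintegral_mono hwb).trans (by simp)))
  rw [h, mul_zero] at hα
  exact hb (le_antisymm hα bot_le)

lemma lintegral_csmc_le (N : ℕ) {f : (Fin (n + 1) → X) → ℝ≥0∞} (hf : Measurable f)
    (hf1 : ∀ x, f x ≤ 1) (r : Fin (n + 1) → X) :
    ∫⁻ x, f x ∂(csmc m₀ q G hG N n r) ≤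
      ∫⁻ x, f x ∂(target m₀ q G n) + ENNReal.ofReal ((n + 1) * (a * c * g⁻¹) / (N + 1)) := by
  have h := lintegral_population_le m₀ q G hG N
    (boundedPotential hG hG0 hg hA1 ha ha0 hc) le_rfl hf hf1 r
  -- At the final time `p` is an empty product, so the weight is the potential that the algorithm
  -- itself uses.
  simp only [pFuture_self, mul_one] at h
  rw [lintegral_csmc m₀ q G hG N r hf, lintegral_target m₀ q G hG hG0 n hf]
  refine h.trans (le_of_eq ?_)
  rw [mul_div_assoc, ENNReal.ofReal_mul (p := (n : ℝ) + 1) (by positivity),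
    ENNReal.ofReal_div_of_pos (by positivity)]
  congr 3
  · exact_mod_cast (ENNReal.ofReal_natCast (n + 1)).symm
  · exact_mod_cast (ENNReal.ofReal_natCast (N + 1)).symm

omit hg hA1 ha ha0 hc in
lemma lintegral_lintegral_csmc (N : ℕ) {f : (Fin (n + 1) → X) → ℝ≥0∞} (hf : Measurable f) :
    ∫⁻ y, ∫⁻ x, f x ∂(csmc m₀ q G hG N n y) ∂(target m₀ q G n) =
      ∫⁻ y, f y ∂(target m₀ q G n) := by
  rw [lintegral_target m₀ q G hG hG0 n hf, lintegral_target m₀ q G hG hG0 n hf.lintegral_kernel,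
    lintegral_csmc_predictive m₀ q G hG N hf]

lemma abs_integral_csmc_sub_le (N : ℕ) {f : (Fin (n + 1) → X) → ℝ} (hf : Measurable f)
    (hf1 : ∀ x, |f x| ≤ 1) (r : Fin (n + 1) → X) :
    |∫ x, f x ∂(csmc m₀ q G hG N n r) - ∫ x, f x ∂(target m₀ q G n)| ≤
      2 * ((n + 1) * (a * c * g⁻¹) / (N + 1)) := by
  have := isProbabilityMeasure_target hG hG0 hg hA1 ha ha0 hc
  have hc0 := hc.1
  exact abs_integral_sub_integral_le (by positivity)
    (fun F hF hF1 => lintegral_csmc_le hG hG0 hg hA1 ha ha0 hc N hF hF1 r) hf hf1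

omit hG ha0 [IsMarkovKernel q] in
-- `c⁻¹ < m₀(G 0) ≤ a` gives `1 ≤ a c`, and `g ≤ 1` by (A1) on the diagonal.
lemma one_le_const : 1 ≤ a * c * g⁻¹ := by
  have : Nonempty X := nonempty_of_isProbabilityMeasure m₀
  have hG0m : ∫ x, G 0 x ∂m₀ ≤ a := by
    calc ∫ x, G 0 x ∂m₀ ≤ ∫ _, a ∂m₀ := integral_mono_of_nonneg
          (ae_of_all _ (hG0 0)) (integrable_const _) (ae_of_all _ (ha 0))
      _ = a := by simp
  have hac : 1 ≤ a * c := by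
    have h := hc.2.1.le.trans hG0m
    rwa [inv_le_iff_one_le_mul₀ hc.1] at h
  exact one_le_mul_of_one_le_of_one_le hac
    ((one_le_inv₀ hg).2 (le_one_of_ratio_bound hG0 hg hA1))

end Main

end CSMC

end

/-! ### The three statements -/

theorem mainTheorem2 {X : Type*} [MeasurableSpace X]
    (m₀ : MeasureTheory.Measure X) [MeasureTheory.IsProbabilityMeasure m₀]
    (q : ProbabilityTheory.Kernel X X) [ProbabilityTheory.IsMarkovKernel q]
    (G : ℕ → X → ℝ) (hG : ∀ k, Measurable (G k)) (hG_nonneg : ∀ k x, 0 ≤ G k x)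
    (hG_zero : 0 < ∫ x, G 0 x ∂m₀)
    (g a : ℝ) (hg : 0 < g) (ha : 0 < a)
    (hA1 : ∀ n k, k < n → ∀ x x',
      g ≤ CSMC.pFuture q G k n x / CSMC.pFuture q G k n x' ∧
      CSMC.pFuture q G k n x / CSMC.pFuture q G k n x' ≤ g⁻¹)
    (hA2 : ∀ n x, G n x ≤ a) :
    (∀ n, ∃ c, CSMC.PotentialBound m₀ q G n c) ∧
    (∀ n c, 1 ≤ n → CSMC.PotentialBound m₀ q G n c →
      ∀ N m : ℕ, 1 ≤ N → 1 ≤ m →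
      ∀ f : (Fin (n + 1) → X) → ℝ, Measurable f → (∀ x, |f x| ≤ 1) → ∀ r : Fin (n + 1) → X,
        |∫ x, f x ∂((CSMC.csmc m₀ q G hG N n ^ m) r) - ∫ x, f x ∂(CSMC.target m₀ q G n)| ≤
          ((2 * (n + 1) * a * c * g⁻¹ - 1) / (N - 1 + 2 * a * c * g⁻¹)
            + n * (a * c * g⁻¹) ^ 2 / N) ^ m) ∧
    (∀ c, (∀ n, CSMC.PotentialBound m₀ q G n c) →
      ∀ C : ℝ, 0 < C → ∀ n N m : ℕ, 1 ≤ n → (N : ℝ) = C * (n + 1) + 1 → 1 ≤ m →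
      ∀ f : (Fin (n + 1) → X) → ℝ, Measurable f → (∀ x, |f x| ≤ 1) → ∀ r : Fin (n + 1) → X,
        |∫ x, f x ∂((CSMC.csmc m₀ q G hG N n ^ m) r) - ∫ x, f x ∂(CSMC.target m₀ q G n)| ≤
          a * c * g⁻¹ * (2 + a * c * g⁻¹) / C) := by
  refine ⟨CSMC.exists_potentialBound hG_nonneg hg hA1 hG_zero, ?_, ?_⟩
  · intro n c hn hc N m hN hm f hf hf1 r
    obtain ⟨m, rfl⟩ := Nat.exists_eq_add_of_le' hm
    have := CSMC.isProbabilityMeasure_target hG hG_nonneg hg hA1 hA2 ha hc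
    have hrate := CSMC.bias_le_rate (n := n) (N := N) (by exact_mod_cast hn)
      (by exact_mod_cast hN) (CSMC.one_le_const hG_nonneg hg hA1 hA2 hc)
    rw [show 2 * ((n : ℝ) + 1) * a * c * g⁻¹ = 2 * (n + 1) * (a * c * g⁻¹) by ring,
      show 2 * a * c * g⁻¹ = 2 * (a * c * g⁻¹) by ring]
    exact CSMC.abs_integral_pow_sub_le_pow
      (fun F hF => CSMC.lintegral_lintegral_csmc hG hG_nonneg N hF)
      (fun f hf hf1 r => (CSMC.abs_integral_csmc_sub_le hG hG_nonneg hg hA1 hA2 ha hc N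
        hf hf1 r).trans hrate) m hf hf1 r
  · intro c hc C hC n N m _ hN hm f hf hf1 r
    obtain ⟨m, rfl⟩ := Nat.exists_eq_add_of_le' hm
    have := CSMC.isProbabilityMeasure_target hG hG_nonneg hg hA1 hA2 ha (hc n)
    have hA := CSMC.one_le_const hG_nonneg hg hA1 hA2 (hc n)
    refine (CSMC.abs_integral_pow_sub_le
      (fun F hF => CSMC.lintegral_lintegral_csmc hG hG_nonneg N hF)
      (fun f hf hf1 r => CSMC.abs_integral_csmc_sub_le hG hG_nonneg hg hA1 hA2 ha (hc n) N
        hf hf1 r) m hf hf1 r).trans ?_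
    rw [hN]
    generalize a * c * g⁻¹ = A at hA
    -- The growth of `N` with `n + 1` cancels the `n + 1` selection biases.
    calc 2 * ((n + 1) * A / (C * (n + 1) + 1 + 1)) ≤ 2 * ((n + 1) * A / (C * (n + 1))) := by
          gcongr
          linarith
      _ = A * 2 / C := by field_simp
      _ ≤ A * (2 + A) / C := by
          gcongr
          linarith
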